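/- **Setting.** A layered tabular MDP with $H$ steps per episode consists of a finite state space $\mathcal S=\mathcal S_0\sqcup\dots\sqcup\mathcal S_H$ with $S=|\mathcal S|$ and nonempty layers, $\mathcal S_0=\{s_0\}$, $\mathcal S_H=\{s_H\}$; an action set $\mathcal A$ with $A=|\mathcal A|$; and a transition kernel $P$ such that $P(\cdot\mid s,a)$ is supported on $\mathcal S_{h+1}$ for $s\in\mathcal S_h$, $h<H$. For a stochastic Markov policy $\pi\in\Pi=\Delta(\mathcal A)^{\mathcal S}$ and $\ell:\mathcal S\times\mathcal A\to[0,1]$, let $V^\pi(s_0;\ell)=\mathbb E\big[\sum_{h=0}^{H-1}\ell(s_h,a_h)\big]$, where $a_h\sim\pi(\cdot\mid s_h)$ and $s_{h+1}\sim P(\cdot\mid s_h,a_h)$. In each episode $t=1,\dots,T$ a (possibly randomized) learner selects a policy $\pi_t\in\Pi$ based on its past observations, executes it from $s_0$, and observes the states, the actions and the losses $\ell_t(s_{t,h},a_{t,h})$ for $h=0,\dots,H-1$. Its regret is $$\mathrm{Reg}_T=\sum_{t=1}^T V^{\pi_t}(s_0;\ell_t)-\min_{\pi\in\Pi}\sum_{t=1}^T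 V^{\pi}(s_0;\ell_t).$$ **Theorem.** There is a universal constant $c>0$ such that the following holds for all $H\ge 3$, $A\ge 5$, $S$ such that $S'=(S-2)/(H-1)$ is a positive integer, and $T\ge SA/H$. There are a layered MDP with $H$ steps, $S$ states, $A$ actions, $S'$ states in each of the layers $\mathcal S_1,\dots,\mathcal S_{H-1}$ and uniformly random transitions to the next layer, $P(s'\mid s,a)=1/|\mathcal S_{h+1}|$ for $s\in\mathcal S_h$, $s'\in\mathcal S_{h+1}$, and an $\epsilon\in(0,1/4]$ such that for every learner (which may know this MDP, $\epsilon$ and $T$): 1. there is a deterministic policy $\pi^\circ:\mathcal S\to\mathcal A$ such that $\mathbb E[\mathrm{Reg}_T]\ge c\sqrt{HSAT}$ when the losses $\ell_t(s,a)$ are drawn independently (over all $t,s,a$, and independently of the learner's randomization and the transitions), $\ell_t(s,a)\sim\mathrm{Ber}(1/2-\epsilon)$ if $a=\pi^\circ(s)$ and $\ell_t(s,a)\sim\mathrm{Ber}(1/2)$ otherwise; 2. there is also a deterministic sequence of loss functions $\ell_1,\dots,\ell_T:\mathcal S\times\mathcal A\to[0,1]$ with $\mathbb E[\mathrm{Reg}_T]\ge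 c\sqrt{HSAT}$. -/

import Mathlib

open scoped BigOperators

noncomputable section

/-- A stochastic Markov policy: an element of `Δ(𝒜)^𝒮`. -/
abbrev Policy (𝒮 𝒜 : Type*) [Fintype 𝒜] : Type _ := 𝒮 → stdSimplex ℝ 𝒜

/-- A loss function `𝒮 × 𝒜 → [0, 1]`. -/
abbrev Loss (𝒮 𝒜 : Type*) : Type _ := 𝒮 → 𝒜 → unitInterval

/-- A tabular MDP with `H` steps per episode whose state space is the disjoint union of the layers
`0, …, H` (a state is sent to its layer by `layer`). The first and the last layer are
the singletons `{s₀}` and `{sH}`, every layer is nonempty, and transitions from a non-terminal state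
go to the next layer. -/
structure LayeredMDP (H : ℕ) (𝒮 𝒜 : Type*) [Fintype 𝒮] where
  s₀ : 𝒮
  sH : 𝒮
  layer : 𝒮 → Fin (H + 1)
  P : 𝒮 → 𝒜 → stdSimplex ℝ 𝒮
  layer_zero : ∀ s, layer s = 0 ↔ s = s₀
  layer_last : ∀ s, layer s = Fin.last H ↔ s = sH
  layer_nonempty : ∀ h, ∃ s, layer s = h
  forward : ∀ s a s', layer s ≠ Fin.last H → (P s a : 𝒮 → ℝ) s' ≠ 0 →
    (layer s' : ℕ) = (layer s : ℕ) + 1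

/-- What the learner has observed in the first `t` episodes: for each of the `H` steps of each
episode the state, the action, and the loss of this state-action pair in this episode. -/
abbrev History (H : ℕ) (𝒮 𝒜 : Type*) (t : ℕ) : Type _ := Fin t → Fin H → 𝒮 × 𝒜 × unitInterval

/-- A randomized learner, with internal randomness `ω ∈ Ω`: in the episode that follows `t` earlier
ones it plays the Markov policy `policy ω t hist`, where `hist` is what it has observed so far. -/
structure Learner (H : ℕ) (𝒮 𝒜 Ω : Type*) [Fintype 𝒜] [MeasurableSpace Ω] where
  policy : Ω → (t : ℕ) → History H 𝒮 𝒜 t → Policy 𝒮 𝒜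
  measurable_policy : ∀ t hist s a, Measurable fun ω => (policy ω t hist s : 𝒜 → ℝ) a

namespace LayeredMDP

variable {H : ℕ} {𝒮 𝒜 Ω : Type*} [Fintype 𝒮] [DecidableEq 𝒮] [Fintype 𝒜] [DecidableEq 𝒜]
  [MeasurableSpace Ω]

/-- The number of states in layer `h`. -/
def layerCard (M : LayeredMDP H 𝒮 𝒜) (h : Fin (H + 1)) : ℕ :=
  (Finset.univ.filter fun s => M.layer s = h).card

/-- Whatever the action, the next state is uniformly distributed on the next layer. -/
def HasUniformTransitions (M : LayeredMDP H 𝒮 𝒜) : Prop :=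
  ∀ s a s', (M.layer s' : ℕ) = (M.layer s : ℕ) + 1 →
    (M.P s a : 𝒮 → ℝ) s' = 1 / (M.layerCard (M.layer s') : ℝ)

/-- The probability that the first `n` state-action pairs of an episode are `x 0, …, x (n - 1)`
when the policy `π` is executed from `s₀`. -/
def pathProb (M : LayeredMDP H 𝒮 𝒜) (π : Policy 𝒮 𝒜) {n : ℕ} (x : Fin n → 𝒮 × 𝒜) : ℝ :=
  ∏ h : Fin n,
    (if (h : ℕ) = 0 then (if (x h).1 = M.s₀ then 1 else 0)
      else (M.P (x ⟨h - 1, by omega⟩).1 (x ⟨h - 1, by omega⟩).2 : 𝒮 → ℝ) (x h).1) *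
    (π (x h).1 : 𝒜 → ℝ) (x h).2

/-- The value `V^π(s₀; ℓ)`: the expected sum of the losses over the `H` steps of an episode. -/
def value (M : LayeredMDP H 𝒮 𝒜) (π : Policy 𝒮 𝒜) (ℓ : Loss 𝒮 𝒜) : ℝ :=
  ∑ x : Fin H → 𝒮 × 𝒜, M.pathProb π x * ∑ h : Fin H, (ℓ (x h).1 (x h).2 : ℝ)

/-- The regret of the policies `π 0, …, π (T - 1)` for the losses `ℓ 0, …, ℓ (T - 1)`, against the
best fixed stochastic Markov policy in hindsight. -/
def regret (M : LayeredMDP H 𝒮 𝒜) {T : ℕ} (ℓ : Fin T → Loss 𝒮 𝒜) (π : Fin T → Policy 𝒮 𝒜) : ℝ :=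
  ∑ t, M.value (π t) (ℓ t) - ⨅ ρ : Policy 𝒮 𝒜, ∑ t, M.value ρ (ℓ t)

/-- The observations made before episode `t` when the state-action pairs are given by `x`. -/
def observations {T : ℕ} (ℓ : Fin T → Loss 𝒮 𝒜) (x : Fin T → Fin H → 𝒮 × 𝒜) (t : Fin T) :
    History H 𝒮 𝒜 (t : ℕ) :=
  fun i h =>
    let j : Fin T := Fin.castLE t.isLt.le i
    ((x j h).1, (x j h).2, ℓ j (x j h).1 (x j h).2)

/-- The policy of episode `t` when the internal randomness is `ω` and the state-action pairs of the
episodes are given by `x` (only the episodes before `t` matter). -/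
def played {T : ℕ} (L : Learner H 𝒮 𝒜 Ω) (ℓ : Fin T → Loss 𝒮 𝒜) (ω : Ω)
    (x : Fin T → Fin H → 𝒮 × 𝒜) (t : Fin T) : Policy 𝒮 𝒜 :=
  L.policy ω (t : ℕ) (observations ℓ x t)

/-- `E[Reg_T]` for the loss sequence `ℓ`. The expectation is over the internal randomness `ω` of the
learner and, given `ω`, over the state-action pairs `x` of the `T` episodes, where those of
episode `t` are drawn by executing the policy selected from the earlier observations. -/
def expectedRegret (M : LayeredMDP H 𝒮 𝒜) (μ : MeasureTheory.Measure Ω) (L : Learner H 𝒮 𝒜 Ω)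
    {T : ℕ} (ℓ : Fin T → Loss 𝒮 𝒜) : ℝ :=
  ∫ ω, ∑ x : Fin T → Fin H → 𝒮 × 𝒜,
    (∏ t, M.pathProb (played L ℓ ω x t) (x t)) * M.regret ℓ (played L ℓ ω x) ∂μ

/-- The loss functions with values in `{0, 1}` that are given by a table of outcomes. -/
def binaryLoss {T : ℕ} (b : Fin T → 𝒮 → 𝒜 → Bool) : Fin T → Loss 𝒮 𝒜 :=
  fun t s a => if b t s a then 1 else 0

/-- `E[Reg_T]` when the losses `ℓ_t(s, a)` are drawn independently (over all `t, s, a`, and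
independently of the randomness of the learner and of the transitions) from the Bernoulli
distributions with means `m s a`. -/
def expectedRegretBernoulli (M : LayeredMDP H 𝒮 𝒜) (μ : MeasureTheory.Measure Ω)
    (L : Learner H 𝒮 𝒜 Ω) (T : ℕ) (m : 𝒮 → 𝒜 → ℝ) : ℝ :=
  ∑ b : Fin T → 𝒮 → 𝒜 → Bool,
    (∏ t, ∏ s, ∏ a, if b t s a then m s a else 1 - m s a) * M.expectedRegret μ L (binaryLoss b)

end LayeredMDP

/-- The mean losses hiding the deterministic policy `π₀`: `1/2 - ε` for its action and `1/2` for
every other action. -/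
def hiddenPolicyMean {𝒮 𝒜 : Type*} [DecidableEq 𝒜] (ε : ℝ) (π₀ : 𝒮 → 𝒜) (s : 𝒮) (a : 𝒜) : ℝ :=
  if a = π₀ s then 1 / 2 - ε else 1 / 2

end

/-! In every state one action is hidden whose mean loss is smaller by `ε`. Since transitions are
uniform whatever the learner does, each inner state is visited with probability `1 / S'` per
episode, and the problem splits into `(H - 1) * S'` bandit problems with about `T / S'` rounds each.
The value is linear in the policy with fixed occupancies (`value_eq`), so the expected regret
against the hidden policy is `ε` times the expected number of visits at which the hidden action is
missed (`le_bernoulliRegret`).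

Fix a state `s` and compare, for each action `a`, the environment hiding `a` at `s` with one
reference environment in which all actions at `s` have mean `1 / 2`. The probability of playing `a`
at `s` grows by at most the square root of the relative entropy between the laws of the observations
(`expectation_seen_sub_le`). This entropy is at most `4 * ε ^ 2` times the expected number of plays
of `(s, a)` in the reference environment. These numbers sum over `a` to `T / S'`, so by
Cauchy–Schwarz the probabilities of playing the hidden action, summed over its `A` possible
positions, are at most `1 + √(4 * ε ^ 2 * A * T / S')` (`sum_actionProb_update_le`).

For `ε ^ 2` of order `S' * A / T` this is at most `A / 2`: a uniformly random hidden action is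
missed at least half of the time, and the regret is at least `ε * (H - 1) * T / 2`, of order `√(H *
S * A * T)`. The average over hidden policies is bounded for each value of the internal randomness,
so integration yields one good hidden policy per learner, and averaging over the loss tables then
yields deterministic losses. -/

/-! ### Adaptively sampled processes, and total variation against relative entropy -/

/-- The weight of `z` under a process that draws `z t` from `k t (z 0, …, z (t - 1))`. -/
def processWeight {Z : Type*} (k : (t : ℕ) → (Fin t → Z) → Z → ℝ) (T : ℕ) (z : Fin T → Z) : ℝ :=
  ∏ t : Fin T, k t (fun i => z (Fin.castLE t.isLt.le i)) (z t)

section ProcessWeights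

variable {Z : Type*} {k : (t : ℕ) → (Fin t → Z) → Z → ℝ}

theorem processWeight_snoc (k : (t : ℕ) → (Fin t → Z) → Z → ℝ) (T : ℕ) (u : Fin T → Z) (y : Z) :
    processWeight k (T + 1) (Fin.snoc (α := fun _ => Z) u y) = processWeight k T u * k T u y := by
  unfold processWeight
  rw [Fin.prod_univ_castSucc]
  have key : ∀ i : Fin T, (Fin.snoc (α := fun _ => Z) u y) i.castSucc = u i := fun i =>
    Fin.snoc_castSucc (α := fun _ => Z) y u i
  congr 1
  · refine Finset.prod_congr rfl fun t _ => ?_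
    rw [key]
    congr 1
    funext i
    exact key (Fin.castLE t.isLt.le i)
  · rw [Fin.snoc_last]
    congr 1
    funext i
    exact key i

theorem processWeight_nonneg (hk : ∀ t u y, 0 ≤ k t u y) (T : ℕ) (z : Fin T → Z) :
    0 ≤ processWeight k T z :=
  Finset.prod_nonneg fun _ _ => hk _ _ _

variable [Fintype Z]

theorem sum_processWeight_succ (k : (t : ℕ) → (Fin t → Z) → Z → ℝ) (T : ℕ)
    (F : (Fin (T + 1) → Z) → ℝ) :
    ∑ z, processWeight k (T + 1) z * F z =
      ∑ u, processWeight k T u * ∑ y, k T u y * F (Fin.snoc (α := fun _ => Z) u y) := by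
  rw [← Equiv.sum_comp (Fin.snocEquiv fun _ : Fin (T + 1) => Z), Fintype.sum_prod_type,
    Finset.sum_comm]
  refine Finset.sum_congr rfl fun u _ => ?_
  rw [Finset.mul_sum]
  refine Finset.sum_congr rfl fun y _ => ?_
  change processWeight k (T + 1) (Fin.snoc (α := fun _ => Z) u y) * F (Fin.snoc u y) = _
  rw [processWeight_snoc, mul_assoc]

/-- What happens after step `t` is irrelevant for the expectation of a function of the steps up to
`t`. -/
theorem sum_processWeight_prefix (hk : ∀ t u, ∑ y, k t u y = 1) {T t : ℕ} (ht : t < T)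
    (f : (Fin t → Z) → Z → ℝ) :
    ∑ z, processWeight k T z * f (fun i => z (Fin.castLE ht.le i)) (z ⟨t, ht⟩) =
      ∑ u, processWeight k t u * ∑ y, k t u y * f u y := by
  induction T with
  | zero => omega
  | succ T ih =>
    rw [sum_processWeight_succ]
    have key : ∀ (u : Fin T → Z) (y : Z) (i : Fin T),
        (Fin.snoc (α := fun _ => Z) u y : Fin (T + 1) → Z) i.castSucc = u i := fun u y i =>
      Fin.snoc_castSucc (α := fun _ => Z) y u i
    rcases Nat.lt_succ_iff_lt_or_eq.mp ht with h | h
    · rw [← ih h]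
      refine Finset.sum_congr rfl fun u _ => ?_
      have e : ∀ y, f (fun i => (Fin.snoc (α := fun _ => Z) u y : Fin (T + 1) → Z)
          (Fin.castLE ht.le i)) ((Fin.snoc (α := fun _ => Z) u y : Fin (T + 1) → Z) ⟨t, ht⟩) =
          f (fun i => u (Fin.castLE h.le i)) (u ⟨t, h⟩) := by
        intro y
        congr 1
        · funext i
          exact key u y (Fin.castLE h.le i)
        · exact key u y ⟨t, h⟩
      simp_rw [e]
      rw [← Finset.sum_mul, hk, one_mul]
    · subst h
      refine Finset.sum_congr rfl fun u _ => ?_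
      congr 1
      refine Finset.sum_congr rfl fun y _ => ?_
      congr 2
      · funext i
        exact key u y i
      · exact Fin.snoc_last (α := fun _ => Z) y u

theorem sum_processWeight (hk : ∀ t u, ∑ y, k t u y = 1) (T : ℕ) :
    ∑ z, processWeight k T z = 1 := by
  induction T with
  | zero => simp [processWeight]
  | succ T ih =>
    have := sum_processWeight_succ k T fun _ => 1
    simp only [mul_one, hk] at this
    rw [this, ih]

/-- Replacing a function of the steps up to `t` by its conditional expectation given the steps
before `t`. -/
theorem sum_processWeight_congr (hk : ∀ t u, ∑ y, k t u y = 1) {T t : ℕ} (ht : t < T)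
    (f g : (Fin t → Z) → Z → ℝ) (hfg : ∀ u, ∑ y, k t u y * f u y = ∑ y, k t u y * g u y) :
    ∑ z, processWeight k T z * f (fun i => z (Fin.castLE ht.le i)) (z ⟨t, ht⟩) =
      ∑ z, processWeight k T z * g (fun i => z (Fin.castLE ht.le i)) (z ⟨t, ht⟩) := by
  rw [sum_processWeight_prefix hk ht f, sum_processWeight_prefix hk ht g]
  simp_rw [hfg]

/-- The bound of total variation by relative entropy, through the Hellinger distance. -/
theorem sum_mul_sub_one_mul_le_sqrt {p r f : Z → ℝ} (hp : ∀ z, 0 ≤ p z) (hp1 : ∑ z, p z = 1)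
    (hr : ∀ z, 0 < r z) (hr1 : ∑ z, p z * r z = 1) (hf0 : ∀ z, 0 ≤ f z) (hf1 : ∀ z, f z ≤ 1) :
    ∑ z, p z * (r z * f z) - ∑ z, p z * f z ≤ √(∑ z, p z * -Real.log (r z)) := by
  set B := ∑ z, p z * √(r z) with hB
  have hsq : ∀ z, √(r z) ^ 2 = r z := fun z => Real.sq_sqrt (hr z).le
  have e1 : ∑ z, p z * (√(r z) - 1) ^ 2 = 2 - 2 * B := by
    have : ∀ z, p z * (√(r z) - 1) ^ 2 = p z * r z + p z - 2 * (p z * √(r z)) := fun z => by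
      rw [← hsq z, Real.sqrt_sq (Real.sqrt_nonneg _)]; ring
    simp_rw [this, Finset.sum_sub_distrib, Finset.sum_add_distrib, ← Finset.mul_sum]
    rw [hr1, hp1]; ring
  have e2 : ∑ z, p z * (√(r z) + 1) ^ 2 = 2 + 2 * B := by
    have : ∀ z, p z * (√(r z) + 1) ^ 2 = p z * r z + p z + 2 * (p z * √(r z)) := fun z => by
      rw [← hsq z, Real.sqrt_sq (Real.sqrt_nonneg _)]; ring
    simp_rw [this, Finset.sum_add_distrib, ← Finset.mul_sum]
    rw [hr1, hp1]; ring
  have hB1 : B ≤ 1 := by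
    have : 0 ≤ 2 - 2 * B := e1 ▸ Finset.sum_nonneg fun z _ => mul_nonneg (hp z) (sq_nonneg _)
    linarith
  -- The squared Hellinger distance is at most the relative entropy, because `-log r = -2 log √r ≥ 2
  -- - 2√r`.
  have hlog : 2 - 2 * B ≤ ∑ z, p z * -Real.log (r z) := by
    rw [← e1]
    have h2 : ∑ z, p z * (√(r z) - 1) ^ 2 = ∑ z, p z * (2 - 2 * √(r z)) := by
      rw [e1]
      simp_rw [mul_sub, Finset.sum_sub_distrib, ← Finset.sum_mul, hp1, mul_left_comm _ (2 : ℝ),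
        ← Finset.mul_sum]
      ring
    rw [h2]
    refine Finset.sum_le_sum fun z _ => mul_le_mul_of_nonneg_left ?_ (hp z)
    have := Real.log_le_sub_one_of_pos (Real.sqrt_pos.mpr (hr z))
    rw [Real.log_sqrt (hr z).le] at this
    linarith
  -- Both laws have mass one, so `f` may be centred at `1 / 2`; factoring `r - 1` through `√r`
  -- prepares Cauchy–Schwarz, and `|f - 1 / 2| ≤ 1 / 2` gives the factor `1 / 4`.
  have e3 : ∑ z, p z * (r z * f z) - ∑ z, p z * f z =
      ∑ z, (√(p z) * (√(r z) - 1)) * (√(p z) * (√(r z) + 1) * (f z - 1 / 2)) := by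
    have : ∀ z, (√(p z) * (√(r z) - 1)) * (√(p z) * (√(r z) + 1) * (f z - 1 / 2)) =
        p z * (r z * f z) - p z * f z - 1 / 2 * (p z * r z) + 1 / 2 * p z := fun z => by
      have h1 := Real.mul_self_sqrt (hp z)
      have h2 := Real.mul_self_sqrt (hr z).le
      calc _ = (√(p z) * √(p z)) * (√(r z) * √(r z) - 1) * (f z - 1 / 2) := by ring
        _ = _ := by rw [h1, h2]; ring
    simp_rw [this, Finset.sum_add_distrib, Finset.sum_sub_distrib, ← Finset.mul_sum]
    rw [hr1, hp1]; ring
  refine Real.le_sqrt_of_sq_le ?_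
  rw [e3]
  refine (Finset.sum_mul_sq_le_sq_mul_sq _ _ _).trans ?_
  have h1 : ∑ z, (√(p z) * (√(r z) - 1)) ^ 2 = 2 - 2 * B := by
    rw [← e1]
    exact Finset.sum_congr rfl fun z _ => by rw [mul_pow, Real.sq_sqrt (hp z)]
  have h2 : ∑ z, (√(p z) * (√(r z) + 1) * (f z - 1 / 2)) ^ 2 ≤ 1 / 4 * (2 + 2 * B) := by
    rw [← e2, Finset.mul_sum]
    refine Finset.sum_le_sum fun z _ => ?_
    rw [mul_pow, mul_pow, Real.sq_sqrt (hp z), mul_comm (1 / 4 : ℝ)]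
    refine mul_le_mul_of_nonneg_left ?_ (mul_nonneg (hp z) (sq_nonneg _))
    nlinarith [hf0 z, hf1 z]
  rw [h1]
  calc (2 - 2 * B) * _ ≤ (2 - 2 * B) * (1 / 4 * (2 + 2 * B)) :=
        mul_le_mul_of_nonneg_left h2 (by linarith)
    _ ≤ (2 - 2 * B) * 1 := mul_le_mul_of_nonneg_left (by linarith) (by linarith)
    _ ≤ _ := by rw [mul_one]; exact hlog

end ProcessWeights

/-! ### Resampling one coordinate; tables of independent Bernoulli entries -/

section Coordinates

variable {ι κ : Type*} [Fintype ι] [DecidableEq ι] [Fintype κ]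

/-- Resampling the value of a function at one point. -/
theorem sum_sum_update [DecidableEq κ] (i : ι) (g : (ι → κ) → ℝ) :
    ∑ c : ι → κ, ∑ a, g (Function.update c i a) = Fintype.card κ * ∑ c : ι → κ, g c := by
  have e : Function.Involutive
      (fun q : (ι → κ) × κ => (Function.update q.1 i q.2, q.1 i)) := by
    rintro ⟨c, a⟩
    simp
  rw [← Fintype.sum_prod_type' fun c a => g (Function.update c i a),
    ← Equiv.sum_comp (Equiv.ofBijective _ e.bijective)]
  simp [Fintype.sum_prod_type, Finset.mul_sum]

end Coordinates

section Tables

variable {𝒮 𝒜 : Type*} [Fintype 𝒮] [Fintype 𝒜]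

/-- The weight of the table `b` when its entries are independent Bernoulli variables with
means `m s a`. -/
def tableWeight (m : 𝒮 → 𝒜 → ℝ) (b : 𝒮 → 𝒜 → Bool) : ℝ :=
  ∏ s, ∏ a, if b s a then m s a else 1 - m s a

theorem tableWeight_nonneg {m : 𝒮 → 𝒜 → ℝ} (h0 : ∀ s a, 0 ≤ m s a) (h1 : ∀ s a, m s a ≤ 1)
    (b : 𝒮 → 𝒜 → Bool) : 0 ≤ tableWeight m b :=
  Finset.prod_nonneg fun s _ => Finset.prod_nonneg fun a _ => by
    have := h0 s a
    have := h1 s a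
    split_ifs <;> linarith

variable [DecidableEq 𝒮] [DecidableEq 𝒜]

theorem sum_tableWeight (m : 𝒮 → 𝒜 → ℝ) : ∑ b, tableWeight m b = 1 := by
  have h := Finset.prod_univ_sum (fun _ : 𝒮 => (Finset.univ : Finset (𝒜 → Bool)))
    fun s c => ∏ a, if c a then m s a else 1 - m s a
  rw [Fintype.piFinset_univ] at h
  unfold tableWeight
  rw [← h]
  refine Finset.prod_eq_one fun s _ => ?_
  have h' := Finset.prod_univ_sum (fun _ : 𝒜 => (Finset.univ : Finset Bool))
    fun a c => if c then m s a else 1 - m s a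
  rw [Fintype.piFinset_univ] at h'
  rw [← h']
  exact Finset.prod_eq_one fun a _ => by simp

/-- The table `b` with its entry at `(s, a)` replaced by `v`. -/
def updateTable (b : 𝒮 → 𝒜 → Bool) (s : 𝒮) (a : 𝒜) (v : Bool) : 𝒮 → 𝒜 → Bool :=
  Function.update b s (Function.update (b s) a v)

omit [Fintype 𝒮] [Fintype 𝒜] in
@[simp] theorem updateTable_self (b : 𝒮 → 𝒜 → Bool) (s : 𝒮) (a : 𝒜) (v : Bool) :
    updateTable b s a v s a = v := by
  simp [updateTable]

omit [Fintype 𝒮] [Fintype 𝒜] in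
theorem updateTable_of_ne (b : 𝒮 → 𝒜 → Bool) {s s' : 𝒮} {a a' : 𝒜} (v : Bool)
    (h : (s', a') ≠ (s, a)) : updateTable b s a v s' a' = b s' a' := by
  unfold updateTable
  by_cases hs : s' = s
  · subst hs
    have : a' ≠ a := fun e => h (by rw [e])
    simp [this]
  · simp [hs]

theorem sum_sum_updateTable (s : 𝒮) (a : 𝒜) (g : (𝒮 → 𝒜 → Bool) → ℝ) :
    ∑ b, ∑ v, g (updateTable b s a v) = 2 * ∑ b, g b := by
  have e : Function.Involutive
      (fun q : (𝒮 → 𝒜 → Bool) × Bool => (updateTable q.1 s a q.2, q.1 s a)) := by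
    rintro ⟨c, v⟩
    simp [updateTable]
  rw [← Fintype.sum_prod_type' fun c v => g (updateTable c s a v),
    ← Equiv.sum_comp (Equiv.ofBijective _ e.bijective)]
  simp only [Equiv.ofBijective_apply, Fintype.sum_prod_type]
  simp [updateTable, Finset.mul_sum, two_mul]

/-- An entry of the table is independent of what does not depend on it. -/
theorem sum_tableWeight_mul (m : 𝒮 → 𝒜 → ℝ) (s : 𝒮) (a : 𝒜) (φ : Bool → ℝ)
    {G : (𝒮 → 𝒜 → Bool) → ℝ} (hG : ∀ b v, G (updateTable b s a v) = G b) :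
    ∑ b, tableWeight m b * (φ (b s a) * G b) =
      (m s a * φ true + (1 - m s a) * φ false) * ∑ b, tableWeight m b * G b := by
  -- `R` is the weight of all the other entries; resampling the entry at `(s, a)` leaves `R` and `G`
  -- unchanged and splits off its two values.
  set R : (𝒮 → 𝒜 → Bool) → ℝ := fun b => ∏ p ∈ (Finset.univ : Finset (𝒮 × 𝒜)).erase (s, a),
    if b p.1 p.2 then m p.1 p.2 else 1 - m p.1 p.2 with hR
  have hW : ∀ b v, tableWeight m (updateTable b s a v) =
      (if v then m s a else 1 - m s a) * R b := by
    intro b v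
    unfold tableWeight
    rw [← Fintype.prod_prod_type' fun s' a' =>
      if updateTable b s a v s' a' then m s' a' else 1 - m s' a',
      ← Finset.mul_prod_erase _ _ (Finset.mem_univ (s, a))]
    simp only [updateTable_self]
    congr 1
    refine Finset.prod_congr rfl fun p hp => ?_
    rw [updateTable_of_ne b v (Finset.ne_of_mem_erase hp)]
  have h1 := sum_sum_updateTable s a fun b => tableWeight m b * (φ (b s a) * G b)
  have h2 := sum_sum_updateTable s a fun b => tableWeight m b * G b
  simp only [hW, updateTable_self, hG, Fintype.sum_bool, if_true, Bool.false_eq_true, if_false]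
    at h1 h2
  have h3 : ∑ b, tableWeight m b * G b = (∑ b, R b * G b) / 2 := by
    rw [eq_div_iff two_ne_zero, mul_comm, ← h2]
    exact Finset.sum_congr rfl fun b _ => by ring
  rw [h3]
  have h4 : ∑ b, (m s a * R b * (φ true * G b) + (1 - m s a) * R b * (φ false * G b)) =
      (m s a * φ true + (1 - m s a) * φ false) * ∑ b, R b * G b := by
    rw [Finset.mul_sum]
    exact Finset.sum_congr rfl fun b _ => by ring
  linarith

theorem sum_tableWeight_entry (m : 𝒮 → 𝒜 → ℝ) (s : 𝒮) (a : 𝒜) (φ : Bool → ℝ) :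
    ∑ b, tableWeight m b * φ (b s a) = m s a * φ true + (1 - m s a) * φ false := by
  have := sum_tableWeight_mul m s a φ (G := fun _ => 1) fun _ _ => rfl
  simpa [sum_tableWeight] using this

/-- Changing the mean of one entry from `1 / 2` to `1 / 2 - ε` multiplies the weight by the
likelihood ratio of this entry. -/
theorem tableWeight_eq_mul (ε : ℝ) {m m' : 𝒮 → 𝒜 → ℝ} {s : 𝒮} {a : 𝒜} (hm : m s a = 1 / 2)
    (hm' : m' s a = 1 / 2 - ε) (h : ∀ s' a', (s', a') ≠ (s, a) → m' s' a' = m s' a')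
    (b : 𝒮 → 𝒜 → Bool) :
    tableWeight m' b = tableWeight m b * if b s a then 1 - 2 * ε else 1 + 2 * ε := by
  unfold tableWeight
  rw [← Fintype.prod_prod_type' fun s' a' => if b s' a' then m' s' a' else 1 - m' s' a',
    ← Fintype.prod_prod_type' fun s' a' => if b s' a' then m s' a' else 1 - m s' a',
    ← Finset.mul_prod_erase _ _ (Finset.mem_univ (s, a)),
    ← Finset.mul_prod_erase _ _ (Finset.mem_univ (s, a)), hm, hm', mul_right_comm]
  congr 1
  · split_ifs <;> ring
  · refine Finset.prod_congr rfl fun p hp => ?_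
    rw [h _ _ (Finset.ne_of_mem_erase hp)]

end Tables

/-! ### Occupancies and values under uniform transitions -/

namespace LayeredMDP

section Layers

variable {H : ℕ} {𝒮 𝒜 : Type*} [Fintype 𝒮] (M : LayeredMDP H 𝒮 𝒜)

theorem layerCard_zero [DecidableEq 𝒮] : M.layerCard 0 = 1 := by
  unfold layerCard
  simp_rw [M.layer_zero]
  simp [Finset.filter_eq']

theorem layerCard_pos (h : Fin (H + 1)) : 0 < M.layerCard h := by
  obtain ⟨s, hs⟩ := M.layer_nonempty h
  exact Finset.card_pos.mpr ⟨s, by simp [hs]⟩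

/-- The probability of being in state `s` at step `h` if transitions are uniform. -/
noncomputable def visitProb (h : ℕ) (s : 𝒮) : ℝ :=
  if (M.layer s : ℕ) = h then 1 / (M.layerCard (M.layer s) : ℝ) else 0

theorem visitProb_nonneg (h : ℕ) (s : 𝒮) : 0 ≤ M.visitProb h s := by
  unfold visitProb
  split_ifs
  · positivity
  · exact le_rfl

theorem sum_visitProb {h : ℕ} (hh : h ≤ H) : ∑ s, M.visitProb h s = 1 := by
  have hp := M.layerCard_pos ⟨h, by omega⟩
  have : ∀ s, M.visitProb h s =
      if M.layer s = ⟨h, by omega⟩ then 1 / (M.layerCard ⟨h, by omega⟩ : ℝ) else 0 := by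
    intro s
    unfold visitProb
    by_cases hs : M.layer s = ⟨h, by omega⟩
    · simp [hs]
    · rw [if_neg hs, if_neg fun e => hs (Fin.ext e)]
  simp_rw [this]
  rw [← Finset.sum_filter, Finset.sum_const, nsmul_eq_mul]
  change (M.layerCard _ : ℝ) * _ = 1
  field_simp

/-- The expected number of visits to `s` in one episode if transitions are uniform. -/
noncomputable def occupancy (s : 𝒮) : ℝ := ∑ h : Fin H, M.visitProb h s

variable {M}

theorem transition_eq_visitProb (hU : M.HasUniformTransitions) {h : ℕ} (hh : h < H) {s : 𝒮}
    (hs : (M.layer s : ℕ) = h) (a : 𝒜) (s' : 𝒮) :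
    (M.P s a : 𝒮 → ℝ) s' = M.visitProb (h + 1) s' := by
  unfold visitProb
  split_ifs with hc
  · exact hU s a s' (by omega)
  · by_contra hne
    have := M.forward s a s' (fun e => by simp [e] at hs; omega) hne
    omega

theorem occupancy_nonneg (s : 𝒮) : 0 ≤ M.occupancy s :=
  Finset.sum_nonneg fun _ _ => M.visitProb_nonneg _ s

theorem occupancy_eq {s : 𝒮} (hs : M.layer s ≠ Fin.last H) :
    M.occupancy s = 1 / (M.layerCard (M.layer s) : ℝ) := by
  have hlt : (M.layer s : ℕ) < H := by
    have := (M.layer s).isLt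
    have : (M.layer s : ℕ) ≠ H := fun e => hs (Fin.ext e)
    omega
  unfold occupancy visitProb
  rw [Finset.sum_eq_single ⟨M.layer s, hlt⟩]
  · simp
  · intro h _ hne
    rw [if_neg]
    exact fun e => hne (Fin.ext e.symm)
  · simp

end Layers

section Paths

variable {H : ℕ} {𝒮 𝒜 : Type*} [Fintype 𝒮] [DecidableEq 𝒮] [Fintype 𝒜]
  (M : LayeredMDP H 𝒮 𝒜) (π : Policy 𝒮 𝒜)

/-- The law of the next state-action pair given the earlier ones. -/
def stepKernel (t : ℕ) (u : Fin t → 𝒮 × 𝒜) (y : 𝒮 × 𝒜) : ℝ :=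
  (if h : t = 0 then (if y.1 = M.s₀ then 1 else 0)
    else (M.P (u ⟨t - 1, by omega⟩).1 (u ⟨t - 1, by omega⟩).2 : 𝒮 → ℝ) y.1) *
    (π y.1 : 𝒜 → ℝ) y.2

theorem pathProb_eq_processWeight {n : ℕ} (x : Fin n → 𝒮 × 𝒜) :
    M.pathProb π x = processWeight (M.stepKernel π) n x := by
  unfold pathProb processWeight stepKernel
  refine Finset.prod_congr rfl fun h _ => ?_
  split_ifs <;> rfl

theorem stepKernel_nonneg (t : ℕ) (u : Fin t → 𝒮 × 𝒜) (y : 𝒮 × 𝒜) : 0 ≤ M.stepKernel π t u y := by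
  unfold stepKernel
  refine mul_nonneg ?_ ((π y.1).2.1 _)
  split_ifs
  · exact zero_le_one
  · exact le_rfl
  · exact (M.P _ _).2.1 _

theorem sum_stepKernel (t : ℕ) (u : Fin t → 𝒮 × 𝒜) : ∑ y, M.stepKernel π t u y = 1 := by
  rw [Fintype.sum_prod_type]
  unfold stepKernel
  have e : ∀ c : 𝒮 → ℝ, ∑ s, ∑ a, c s * (π s : 𝒜 → ℝ) a = ∑ s, c s := fun c =>
    Finset.sum_congr rfl fun s _ => by rw [← Finset.mul_sum, stdSimplex.sum_eq_one, mul_one]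
  split_ifs
  · exact (e fun s => if s = M.s₀ then 1 else 0).trans (by simp)
  · exact (e _).trans (M.P _ _).2.2

theorem pathProb_nonneg {n : ℕ} (x : Fin n → 𝒮 × 𝒜) : 0 ≤ M.pathProb π x := by
  rw [pathProb_eq_processWeight]
  exact processWeight_nonneg (M.stepKernel_nonneg π) n x

theorem sum_pathProb (n : ℕ) : ∑ x : Fin n → 𝒮 × 𝒜, M.pathProb π x = 1 := by
  simp_rw [pathProb_eq_processWeight]
  exact sum_processWeight (M.sum_stepKernel π) n

variable {M}

/-- The next state is drawn without regard to the current state and action, so the state at step `t`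
is uniform on its layer for every policy; the policy only decides the action there. The bound `n ≤
H` keeps every transition used away from the terminal layer. -/
theorem sum_pathProb_mul_step (hU : M.HasUniformTransitions) {n t : ℕ} (ht : t < n) (hn : n ≤ H)
    (f : 𝒮 × 𝒜 → ℝ) :
    ∑ x : Fin n → 𝒮 × 𝒜, M.pathProb π x * f (x ⟨t, ht⟩) =
      ∑ s, M.visitProb t s * ∑ a, (π s : 𝒜 → ℝ) a * f (s, a) := by
  simp_rw [pathProb_eq_processWeight]
  induction t generalizing n f with
  | zero =>
    rw [sum_processWeight_prefix (M.sum_stepKernel π) ht fun _ y => f y]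
    have e : ∀ s, M.visitProb 0 s = if s = M.s₀ then 1 else 0 := by
      intro s
      unfold visitProb
      have : (M.layer s : ℕ) = 0 ↔ s = M.s₀ := by
        rw [← M.layer_zero]
        exact (Fin.ext_iff (a := M.layer s) (b := 0)).symm
      simp only [this]
      split_ifs with h
      · rw [(M.layer_zero s).mpr h, layerCard_zero]
        simp
      · rfl
    simp_rw [e]
    simp [processWeight, stepKernel, Fintype.sum_prod_type]
  | succ t ih =>
    rw [sum_processWeight_prefix (M.sum_stepKernel π) ht fun _ y => f y]
    have e : ∀ u : Fin (t + 1) → 𝒮 × 𝒜, ∑ y, M.stepKernel π (t + 1) u y * f y =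
        (fun q : 𝒮 × 𝒜 => ∑ s, (M.P q.1 q.2 : 𝒮 → ℝ) s * ∑ a, (π s : 𝒜 → ℝ) a * f (s, a))
          (u ⟨t, t.lt_succ_self⟩) := by
      intro u
      simp [stepKernel, Fintype.sum_prod_type, mul_assoc, Finset.mul_sum]
    refine (Finset.sum_congr rfl fun u _ => by rw [e u]).trans ?_
    refine (ih (n := t + 1) t.lt_succ_self (by omega) fun q =>
      ∑ s, (M.P q.1 q.2 : 𝒮 → ℝ) s * ∑ a, (π s : 𝒜 → ℝ) a * f (s, a)).trans ?_
    have e' : ∀ s, M.visitProb t s * ∑ a, (π s : 𝒜 → ℝ) a *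
        ∑ s', (M.P s a : 𝒮 → ℝ) s' * ∑ a', (π s' : 𝒜 → ℝ) a' * f (s', a') =
        M.visitProb t s *
          ∑ s', M.visitProb (t + 1) s' * ∑ a', (π s' : 𝒜 → ℝ) a' * f (s', a') := by
      intro s
      by_cases hs : (M.layer s : ℕ) = t
      · simp_rw [fun a s' => transition_eq_visitProb hU (by omega : t < H) hs a s']
        rw [← Finset.sum_mul, stdSimplex.sum_eq_one, one_mul]
      · simp [visitProb, hs]
    simp_rw [e']
    rw [← Finset.sum_mul, M.sum_visitProb (by omega), one_mul]

theorem sum_pathProb_mul_sum (hU : M.HasUniformTransitions) (f : 𝒮 × 𝒜 → ℝ) :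
    ∑ x : Fin H → 𝒮 × 𝒜, M.pathProb π x * ∑ h, f (x h) =
      ∑ s, M.occupancy s * ∑ a, (π s : 𝒜 → ℝ) a * f (s, a) := by
  simp_rw [Finset.mul_sum (Finset.univ : Finset (Fin H))]
  rw [Finset.sum_comm]
  have := fun h : Fin H => sum_pathProb_mul_step π hU h.isLt le_rfl f
  simp only [Fin.eta] at this
  simp_rw [this, occupancy, Finset.sum_mul]
  rw [Finset.sum_comm]

theorem value_eq (hU : M.HasUniformTransitions) (ℓ : Loss 𝒮 𝒜) :
    M.value π ℓ = ∑ s, M.occupancy s * ∑ a, (π s : 𝒜 → ℝ) a * (ℓ s a : ℝ) :=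
  sum_pathProb_mul_sum π hU fun q => (ℓ q.1 q.2 : ℝ)

/-- In one episode, the expected number of occurrences of a state-action pair bounds its
probability of occurring. -/
theorem sum_pathProb_occurs_le [DecidableEq 𝒜] (hU : M.HasUniformTransitions) (s : 𝒮) (a : 𝒜) :
    (∑ x : Fin H → 𝒮 × 𝒜, M.pathProb π x * if ∃ h, x h = (s, a) then 1 else 0) ≤
      M.occupancy s * (π s : 𝒜 → ℝ) a := by
  have h := sum_pathProb_mul_sum π hU fun q => if q = (s, a) then (1 : ℝ) else 0
  have h' : ∑ s', M.occupancy s' * ∑ a', (π s' : 𝒜 → ℝ) a' *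
      (if (s', a') = (s, a) then (1 : ℝ) else 0) = M.occupancy s * (π s : 𝒜 → ℝ) a := by
    rw [Finset.sum_eq_single s]
    · simp
    · intro s' _ hne
      simp [hne]
    · simp
  rw [← h', ← h]
  refine Finset.sum_le_sum fun x _ => mul_le_mul_of_nonneg_left ?_ (M.pathProb_nonneg π x)
  split_ifs with hx
  · obtain ⟨i, hi⟩ := hx
    have := Finset.single_le_sum (f := fun h => if x h = (s, a) then (1 : ℝ) else 0)
      (fun _ _ => by positivity) (Finset.mem_univ i)
    simpa [hi] using this
  · exact Finset.sum_nonneg fun _ _ => by positivity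

end Paths

end LayeredMDP

/-! ### Episodes as rounds, and change of measure on the observations -/

namespace LayeredMDP

/-- The loss table and the path of one episode. -/
abbrev Round (H : ℕ) (𝒮 𝒜 : Type*) : Type _ := (𝒮 → 𝒜 → Bool) × (Fin H → 𝒮 × 𝒜)

/-- What the learner observes in one episode. -/
def Round.seen {H : ℕ} {𝒮 𝒜 : Type*} (y : Round H 𝒮 𝒜) : Fin H → 𝒮 × 𝒜 × unitInterval :=
  fun h => ((y.2 h).1, (y.2 h).2, if y.1 (y.2 h).1 (y.2 h).2 then 1 else 0)

/-- The policy of episode `t` for a learner without internal randomness. -/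
def policyAt {H : ℕ} {𝒮 𝒜 : Type*} [Fintype 𝒜]
    (pol : (t : ℕ) → History H 𝒮 𝒜 t → Policy 𝒮 𝒜) (t : ℕ) (u : Fin t → Round H 𝒮 𝒜) :
    Policy 𝒮 𝒜 :=
  pol t fun i => (u i).seen

section Seen

variable {H : ℕ} {𝒮 𝒜 : Type*} [DecidableEq 𝒮] [DecidableEq 𝒜]

/-- The likelihood ratio of what is observed in one episode when the mean loss of `(s, a)` changes
from `1 / 2` to `1 / 2 - ε`. -/
def seenRatio (ε : ℝ) (s : 𝒮) (a : 𝒜) (y : Round H 𝒮 𝒜) : ℝ :=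
  if ∃ h, y.2 h = (s, a) then (if y.1 s a then 1 - 2 * ε else 1 + 2 * ε) else 1

theorem seen_updateTable {x : Fin H → 𝒮 × 𝒜} {s : 𝒮} {a : 𝒜} (hx : ¬∃ h, x h = (s, a))
    (b : 𝒮 → 𝒜 → Bool) (v : Bool) :
    Round.seen (updateTable b s a v, x) = Round.seen (b, x) := by
  unfold Round.seen
  funext h
  have : ((x h).1, (x h).2) ≠ (s, a) := fun e => hx ⟨h, e⟩
  simp only [updateTable_of_ne b v this]

end Seen

section Rounds

variable {H : ℕ} {𝒮 𝒜 : Type*} [Fintype 𝒮] [DecidableEq 𝒮] [Fintype 𝒜]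
  (M : LayeredMDP H 𝒮 𝒜) (pol : (t : ℕ) → History H 𝒮 𝒜 t → Policy 𝒮 𝒜) (m : 𝒮 → 𝒜 → ℝ)

/-- The law of an episode given the earlier ones. -/
def roundKernel (t : ℕ) (u : Fin t → Round H 𝒮 𝒜) (y : Round H 𝒮 𝒜) : ℝ :=
  tableWeight m y.1 * M.pathProb (policyAt pol t u) y.2

/-- The expectation over `T` episodes with independent Bernoulli losses. -/
def expectation [DecidableEq 𝒜] (T : ℕ) (F : (Fin T → Round H 𝒮 𝒜) → ℝ) : ℝ :=
  ∑ z, processWeight (M.roundKernel pol m) T z * F z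

theorem roundKernel_nonneg {m : 𝒮 → 𝒜 → ℝ} (h0 : ∀ s a, 0 ≤ m s a) (h1 : ∀ s a, m s a ≤ 1)
    (t : ℕ) (u : Fin t → Round H 𝒮 𝒜) (y : Round H 𝒮 𝒜) : 0 ≤ M.roundKernel pol m t u y :=
  mul_nonneg (tableWeight_nonneg h0 h1 _) (M.pathProb_nonneg _ _)

variable [DecidableEq 𝒜]

theorem sum_roundKernel_mul (t : ℕ) (u : Fin t → Round H 𝒮 𝒜) (f : Round H 𝒮 𝒜 → ℝ) :
    ∑ y, M.roundKernel pol m t u y * f y =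
      ∑ x, M.pathProb (policyAt pol t u) x * ∑ b, tableWeight m b * f (b, x) := by
  rw [Fintype.sum_prod_type, Finset.sum_comm]
  simp_rw [Finset.mul_sum, roundKernel]
  exact Finset.sum_congr rfl fun x _ => Finset.sum_congr rfl fun b _ => by ring

theorem sum_roundKernel_mul_table (t : ℕ) (u : Fin t → Round H 𝒮 𝒜) (f : (𝒮 → 𝒜 → Bool) → ℝ) :
    ∑ y, M.roundKernel pol m t u y * f y.1 = ∑ b, tableWeight m b * f b := by
  rw [sum_roundKernel_mul M pol m t u fun y => f y.1]
  dsimp only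
  rw [← Finset.sum_mul, sum_pathProb, one_mul]

theorem sum_roundKernel (t : ℕ) (u : Fin t → Round H 𝒮 𝒜) :
    ∑ y, M.roundKernel pol m t u y = 1 := by
  simpa [sum_tableWeight] using sum_roundKernel_mul_table M pol m t u fun _ => 1

variable {M pol m} in
theorem expectation_mono (h0 : ∀ s a, 0 ≤ m s a) (h1 : ∀ s a, m s a ≤ 1) {T : ℕ}
    {F G : (Fin T → Round H 𝒮 𝒜) → ℝ} (h : ∀ z, F z ≤ G z) :
    M.expectation pol m T F ≤ M.expectation pol m T G :=
  Finset.sum_le_sum fun z _ => mul_le_mul_of_nonneg_left (h z)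
    (processWeight_nonneg (M.roundKernel_nonneg pol h0 h1) T z)

theorem expectation_const (T : ℕ) (c : ℝ) : M.expectation pol m T (fun _ => c) = c := by
  unfold expectation
  rw [← Finset.sum_mul, sum_processWeight (M.sum_roundKernel pol m), one_mul]

theorem expectation_sum {ι : Type*} (I : Finset ι) (T : ℕ) (F : ι → (Fin T → Round H 𝒮 𝒜) → ℝ) :
    M.expectation pol m T (fun z => ∑ i ∈ I, F i z) = ∑ i ∈ I, M.expectation pol m T (F i) := by
  unfold expectation
  simp_rw [Finset.mul_sum]
  exact Finset.sum_comm

theorem expectation_const_mul (T : ℕ) (c : ℝ) (F : (Fin T → Round H 𝒮 𝒜) → ℝ) :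
    M.expectation pol m T (fun z => c * F z) = c * M.expectation pol m T F := by
  unfold expectation
  rw [Finset.mul_sum]
  exact Finset.sum_congr rfl fun z _ => by ring

theorem expectation_sub (T : ℕ) (F G : (Fin T → Round H 𝒮 𝒜) → ℝ) :
    M.expectation pol m T (fun z => F z - G z) =
      M.expectation pol m T F - M.expectation pol m T G := by
  unfold expectation
  simp_rw [mul_sub]
  exact Finset.sum_sub_distrib _ _

/-- The losses of episode `t` are independent of the earlier episodes. -/
theorem expectation_sum_mul_loss {T : ℕ} (t : Fin T)
    (c : (Fin (t : ℕ) → Round H 𝒮 𝒜) → 𝒮 → 𝒜 → ℝ) :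
    M.expectation pol m T (fun z => ∑ s, ∑ a, c (fun i => z (Fin.castLE t.isLt.le i)) s a *
        if (z t).1 s a then 1 else 0) =
      M.expectation pol m T (fun z => ∑ s, ∑ a, c (fun i => z (Fin.castLE t.isLt.le i)) s a *
        m s a) := by
  refine sum_processWeight_congr (M.sum_roundKernel pol m) t.isLt
    (fun u y => ∑ s, ∑ a, c u s a * if y.1 s a then 1 else 0)
    (fun u _ => ∑ s, ∑ a, c u s a * m s a) fun u => ?_
  rw [← Finset.sum_mul, sum_roundKernel, one_mul,
    sum_roundKernel_mul_table M pol m t u fun b => ∑ s, ∑ a, c u s a * if b s a then 1 else 0]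
  simp_rw [Finset.mul_sum]
  rw [Finset.sum_comm]
  refine Finset.sum_congr rfl fun s _ => ?_
  rw [Finset.sum_comm]
  refine Finset.sum_congr rfl fun a _ => ?_
  have := sum_tableWeight_entry m s a fun v => if v then 1 else 0
  simp only [if_true, Bool.false_eq_true, if_false, mul_one, mul_zero, add_zero] at this
  rw [← this, Finset.mul_sum]
  exact Finset.sum_congr rfl fun b _ => by ring

section ChangeOfMeasure

variable {ε : ℝ} {m m' : 𝒮 → 𝒜 → ℝ} {s : 𝒮} {a : 𝒜} (hm : m s a = 1 / 2)
  (hm' : m' s a = 1 / 2 - ε) (h : ∀ s' a', (s', a') ≠ (s, a) → m' s' a' = m s' a')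

include hm hm' h

/-- On a path through `(s, a)` the ratio of the table weights is `seenRatio`. On any other path the
observation does not depend on the changed entry, which can be averaged out, and the likelihood
ratio has mean one. Thus unobserved losses carry no information. -/
theorem sum_roundKernel_mul_seenRatio (t : ℕ) (u : Fin t → Round H 𝒮 𝒜)
    (Φ : (Fin H → 𝒮 × 𝒜 × unitInterval) → ℝ) :
    ∑ y, M.roundKernel pol m' t u y * Φ y.seen =
      ∑ y, M.roundKernel pol m t u y * (seenRatio ε s a y * Φ y.seen) := by
  rw [sum_roundKernel_mul M pol m' t u fun y => Φ y.seen,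
    sum_roundKernel_mul M pol m t u fun y => seenRatio ε s a y * Φ y.seen]
  refine Finset.sum_congr rfl fun x _ => ?_
  congr 1
  simp_rw [tableWeight_eq_mul ε hm hm' h, mul_assoc]
  by_cases hx : ∃ h, x h = (s, a)
  · simp [seenRatio, hx]
  · rw [sum_tableWeight_mul m s a (fun v => if v then 1 - 2 * ε else 1 + 2 * ε)
      (G := fun b => Φ (Round.seen (b, x))) fun b v => by simp only [seen_updateTable hx]]
    simp only [seenRatio, hx, if_false, if_true, Bool.false_eq_true, one_mul]
    rw [hm]
    ring

/-- The likelihood ratios of the episodes multiply. Restricting to functions of the observations is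
essential: after integrating out the last episode, the result is again a function of earlier
observations, as the learner's policy is. -/
theorem expectation_seen_eq (T : ℕ) (F : (Fin T → Fin H → 𝒮 × 𝒜 × unitInterval) → ℝ) :
    M.expectation pol m' T (fun z => F fun t => (z t).seen) =
      M.expectation pol m T (fun z => (∏ t, seenRatio ε s a (z t)) * F fun t => (z t).seen) := by
  unfold expectation
  induction T with
  | zero => simp [processWeight]
  | succ T ih =>
    have hsnoc : ∀ (u : Fin T → Round H 𝒮 𝒜) (y : Round H 𝒮 𝒜),
        (fun t : Fin (T + 1) => (Fin.snoc (α := fun _ => Round H 𝒮 𝒜) u y t).seen) =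
          Fin.snoc (α := fun _ => Fin H → 𝒮 × 𝒜 × unitInterval) (fun t => (u t).seen) y.seen := by
      intro u y
      funext t
      refine Fin.lastCases ?_ (fun i => ?_) t
      · simp
      · simp
    rw [sum_processWeight_succ, sum_processWeight_succ]
    have e := ih fun o => ∑ y : Round H 𝒮 𝒜, tableWeight m' y.1 * M.pathProb (pol T o) y.2 *
      F (Fin.snoc (α := fun _ => Fin H → 𝒮 × 𝒜 × unitInterval) o y.seen)
    simp_rw [hsnoc]
    refine e.trans (Finset.sum_congr rfl fun u _ => ?_)
    congr 1
    simp_rw [Fin.prod_univ_castSucc, Fin.snoc_castSucc, Fin.snoc_last]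
    refine (congrArg _ (sum_roundKernel_mul_seenRatio M pol hm hm' h T u fun o =>
      F (Fin.snoc (α := fun _ => Fin H → 𝒮 × 𝒜 × unitInterval) (fun t => (u t).seen) o))).trans ?_
    rw [Finset.mul_sum]
    exact Finset.sum_congr rfl fun y _ => by ring

end ChangeOfMeasure

/-- The expected log-likelihood ratio of what is observed is proportional to the expected number of
observations of the changed entry. -/
theorem sum_roundKernel_mul_neg_log_le (hU : M.HasUniformTransitions) {ε : ℝ} (hε : 0 ≤ ε)
    (hε' : ε < 1 / 2) {s : 𝒮} {a : 𝒜} (hm : m s a = 1 / 2) (t : ℕ) (u : Fin t → Round H 𝒮 𝒜) :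
    ∑ y, M.roundKernel pol m t u y * -Real.log (seenRatio ε s a y) ≤
      -Real.log (1 - 4 * ε ^ 2) / 2 *
        (M.occupancy s * (policyAt pol t u s : 𝒜 → ℝ) a) := by
  have hK : 0 ≤ -Real.log (1 - 4 * ε ^ 2) / 2 := by
    have := Real.log_nonpos (x := 1 - 4 * ε ^ 2) (by nlinarith) (by nlinarith)
    linarith
  rw [sum_roundKernel_mul]
  refine le_trans (le_of_eq ?_)
    (mul_le_mul_of_nonneg_left (sum_pathProb_occurs_le (policyAt pol t u) hU s a) hK)
  rw [Finset.mul_sum]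
  refine Finset.sum_congr rfl fun x _ => ?_
  by_cases hx : ∃ h, x h = (s, a)
  · have e := sum_tableWeight_entry m s a fun v =>
      -Real.log (if v then 1 - 2 * ε else 1 + 2 * ε)
    simp only [seenRatio, hx, if_true]
    rw [e, hm]
    have : (1 - 4 * ε ^ 2) = (1 - 2 * ε) * (1 + 2 * ε) := by ring
    rw [this, Real.log_mul (by linarith) (by linarith)]
    simp only [if_true, Bool.false_eq_true, if_false]
    ring
  · simp [seenRatio, hx]

/-- The chain rule turns the relative entropy of the observations into a sum over episodes. The
factor `-log (1 - 4 * ε ^ 2) / 2` is the relative entropy of `Ber(1/2)` with respect to `Ber(1/2 -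
ε)`. The plays are counted under `m`, which later serves as a reference common to all actions. -/
theorem expectation_seen_sub_le (hU : M.HasUniformTransitions) {ε : ℝ} (hε : 0 ≤ ε)
    (hε' : ε < 1 / 2) {m m' : 𝒮 → 𝒜 → ℝ} {s : 𝒮} {a : 𝒜} (h0 : ∀ s a, 0 ≤ m s a)
    (h1 : ∀ s a, m s a ≤ 1) (hm : m s a = 1 / 2) (hm' : m' s a = 1 / 2 - ε)
    (h : ∀ s' a', (s', a') ≠ (s, a) → m' s' a' = m s' a') {T : ℕ}
    (F : (Fin T → Fin H → 𝒮 × 𝒜 × unitInterval) → ℝ) (hF0 : ∀ o, 0 ≤ F o) (hF1 : ∀ o, F o ≤ 1) :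
    M.expectation pol m' T (fun z => F fun t => (z t).seen) -
        M.expectation pol m T (fun z => F fun t => (z t).seen) ≤
      √(-Real.log (1 - 4 * ε ^ 2) / 2 * (M.occupancy s * ∑ t : Fin T, M.expectation pol m T fun z =>
        (policyAt pol t (fun i => z (Fin.castLE t.isLt.le i)) s : 𝒜 → ℝ) a)) := by
  have hpos : ∀ y : Round H 𝒮 𝒜, 0 < seenRatio ε s a y := by
    intro y
    unfold seenRatio
    split_ifs <;> linarith
  have hr1 := expectation_seen_eq M pol hm hm' h T fun _ => 1
  rw [expectation_const] at hr1
  simp only [mul_one] at hr1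
  rw [expectation_seen_eq M pol hm hm' h T F]
  refine (sum_mul_sub_one_mul_le_sqrt (processWeight_nonneg (M.roundKernel_nonneg pol h0 h1) T)
    (sum_processWeight (M.sum_roundKernel pol m) T)
    (fun z => Finset.prod_pos fun t _ => hpos (z t)) hr1.symm
    (fun z => hF0 fun t => (z t).seen) (fun z => hF1 fun t => (z t).seen)).trans ?_
  refine Real.sqrt_le_sqrt ?_
  have e : ∀ z : Fin T → Round H 𝒮 𝒜, -Real.log (∏ t, seenRatio ε s a (z t)) =
      ∑ t, -Real.log (seenRatio ε s a (z t)) := fun z => by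
    rw [Real.log_prod fun t _ => (hpos (z t)).ne', Finset.sum_neg_distrib]
  simp_rw [e]
  change M.expectation pol m T (fun z => ∑ t, -Real.log (seenRatio ε s a (z t))) ≤ _
  rw [expectation_sum, Finset.mul_sum, Finset.mul_sum]
  refine Finset.sum_le_sum fun t _ => ?_
  rw [← expectation_const_mul, ← expectation_const_mul]
  unfold expectation
  rw [sum_processWeight_prefix (M.sum_roundKernel pol m) t.isLt
      fun _ y => -Real.log (seenRatio ε s a y),
    sum_processWeight_prefix (M.sum_roundKernel pol m) t.isLt fun u _ =>
      -Real.log (1 - 4 * ε ^ 2) / 2 * (M.occupancy s * (policyAt pol t u s : 𝒜 → ℝ) a)]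
  refine Finset.sum_le_sum fun u _ => mul_le_mul_of_nonneg_left ?_
    (processWeight_nonneg (M.roundKernel_nonneg pol h0 h1) t u)
  rw [← Finset.sum_mul, sum_roundKernel, one_mul]
  exact M.sum_roundKernel_mul_neg_log_le pol m hU hε hε' hm t u

end Rounds

end LayeredMDP

/-! ### Regret against the hidden policy, averaged over hidden policies -/

namespace LayeredMDP

theorem hiddenPolicyMean_nonneg {𝒮 𝒜 : Type*} [DecidableEq 𝒜] {ε : ℝ} (hε' : ε ≤ 1 / 2)
    (π₀ : 𝒮 → 𝒜) (s : 𝒮) (a : 𝒜) : 0 ≤ hiddenPolicyMean ε π₀ s a := by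
  unfold hiddenPolicyMean
  split_ifs <;> linarith

theorem hiddenPolicyMean_le_one {𝒮 𝒜 : Type*} [DecidableEq 𝒜] {ε : ℝ} (hε : 0 ≤ ε)
    (π₀ : 𝒮 → 𝒜) (s : 𝒮) (a : 𝒜) : hiddenPolicyMean ε π₀ s a ≤ 1 := by
  unfold hiddenPolicyMean
  split_ifs <;> linarith

/-- The deterministic policy `π₀` as a stochastic policy. -/
noncomputable def diracPolicy {𝒮 𝒜 : Type*} [Fintype 𝒜] [DecidableEq 𝒜]
    (π₀ : 𝒮 → 𝒜) : Policy 𝒮 𝒜 :=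
  fun s => ⟨Pi.single (π₀ s) 1, single_mem_stdSimplex ℝ _⟩

theorem diracPolicy_apply {𝒮 𝒜 : Type*} [Fintype 𝒜] [DecidableEq 𝒜]
    (π₀ : 𝒮 → 𝒜) (s : 𝒮) (a : 𝒜) :
    (diracPolicy π₀ s : 𝒜 → ℝ) a = if a = π₀ s then 1 else 0 := by
  change (Pi.single (π₀ s) (1 : ℝ) : 𝒜 → ℝ) a = _
  rw [Pi.single_apply]

theorem sum_sub_dirac_mul_hiddenPolicyMean {𝒮 𝒜 : Type*} [Fintype 𝒜] [DecidableEq 𝒜] (ε : ℝ)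
    (π₀ : 𝒮 → 𝒜) (p : stdSimplex ℝ 𝒜) (s : 𝒮) :
    ∑ a, ((p : 𝒜 → ℝ) a - (diracPolicy π₀ s : 𝒜 → ℝ) a) * hiddenPolicyMean ε π₀ s a =
      ε * (1 - (p : 𝒜 → ℝ) (π₀ s)) := by
  have e : ∀ a, hiddenPolicyMean ε π₀ s a = 1 / 2 - ε * if a = π₀ s then 1 else 0 := fun a => by
    unfold hiddenPolicyMean
    split_ifs <;> ring
  simp_rw [e, mul_sub, Finset.sum_sub_distrib, ← Finset.sum_mul, Finset.sum_sub_distrib,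
    stdSimplex.sum_eq_one, diracPolicy_apply]
  simp
  ring

section Regret

variable {H : ℕ} {𝒮 𝒜 : Type*} [Fintype 𝒮] [DecidableEq 𝒮] [Fintype 𝒜] {M : LayeredMDP H 𝒮 𝒜}

theorem value_nonneg (π : Policy 𝒮 𝒜) (ℓ : Loss 𝒮 𝒜) : 0 ≤ M.value π ℓ :=
  Finset.sum_nonneg fun x _ => mul_nonneg (M.pathProb_nonneg π x)
    (Finset.sum_nonneg fun h _ => (ℓ (x h).1 (x h).2).2.1)

theorem sum_value_sub_value_le_regret {T : ℕ} (ℓ : Fin T → Loss 𝒮 𝒜) (π : Fin T → Policy 𝒮 𝒜)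
    (ρ : Policy 𝒮 𝒜) : ∑ t, (M.value (π t) (ℓ t) - M.value ρ (ℓ t)) ≤ M.regret ℓ π := by
  unfold regret
  rw [Finset.sum_sub_distrib]
  refine sub_le_sub_left (ciInf_le (f := fun ρ => ∑ t, M.value ρ (ℓ t)) ⟨0, ?_⟩ ρ) _
  rintro _ ⟨ρ, rfl⟩
  exact Finset.sum_nonneg fun t _ => value_nonneg ρ (ℓ t)

variable [DecidableEq 𝒜]

variable (pol : (t : ℕ) → History H 𝒮 𝒜 t → Policy 𝒮 𝒜)

variable (M) in
/-- The expected regret for a learner without internal randomness, when the losses are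
Bernoulli. -/
noncomputable def bernoulliRegret (m : 𝒮 → 𝒜 → ℝ) (T : ℕ) : ℝ :=
  M.expectation pol m T fun z => M.regret (binaryLoss fun t => (z t).1)
    fun t => policyAt pol t fun i => z (Fin.castLE t.isLt.le i)

/-- The probability that the action in state `s` in episode `t` would be `a`. -/
noncomputable def actionProb (M : LayeredMDP H 𝒮 𝒜) (m : 𝒮 → 𝒜 → ℝ) {T : ℕ} (t : Fin T) (s : 𝒮)
    (a : 𝒜) : ℝ :=
  M.expectation pol m T fun z =>
    (policyAt pol t (fun i => z (Fin.castLE t.isLt.le i)) s : 𝒜 → ℝ) a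

/-- The hidden policy serves as comparator. Given the past, the losses of an episode may be replaced
by their means, and in each state the gap is `ε` times the probability of missing the hidden action.
-/
theorem le_bernoulliRegret (hU : M.HasUniformTransitions) {ε : ℝ} (hε : 0 ≤ ε) (hε' : ε ≤ 1 / 2)
    (π₀ : 𝒮 → 𝒜) (T : ℕ) :
    ε * ∑ s, M.occupancy s *
        ∑ t : Fin T, (1 - actionProb pol M (hiddenPolicyMean ε π₀) t s (π₀ s)) ≤
      M.bernoulliRegret pol (hiddenPolicyMean ε π₀) T := by
  refine le_trans ?_ (expectation_mono (hiddenPolicyMean_nonneg hε' π₀)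
    (hiddenPolicyMean_le_one hε π₀) fun z =>
    sum_value_sub_value_le_regret _ _ (diracPolicy π₀))
  rw [expectation_sum]
  have key : ∀ t : Fin T, M.expectation pol (hiddenPolicyMean ε π₀) T (fun z =>
      M.value (policyAt pol t fun i => z (Fin.castLE t.isLt.le i))
          (binaryLoss (fun t => (z t).1) t) -
        M.value (diracPolicy π₀) (binaryLoss (fun t => (z t).1) t)) =
      ∑ s, M.occupancy s *
        (ε * (1 - actionProb pol M (hiddenPolicyMean ε π₀) t s (π₀ s))) := by
    intro t
    have e := M.expectation_sum_mul_loss pol (hiddenPolicyMean ε π₀) t fun u s a =>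
      M.occupancy s * ((policyAt pol t u s : 𝒜 → ℝ) a - (diracPolicy π₀ s : 𝒜 → ℝ) a)
    simp_rw [mul_assoc, ← Finset.mul_sum, sum_sub_dirac_mul_hiddenPolicyMean] at e
    have e1 : ∀ s, M.expectation pol (hiddenPolicyMean ε π₀) T (fun z => M.occupancy s * (ε *
        (1 - (policyAt pol t (fun i => z (Fin.castLE t.isLt.le i)) s : 𝒜 → ℝ) (π₀ s)))) =
        M.occupancy s * (ε * (1 - actionProb pol M (hiddenPolicyMean ε π₀) t s (π₀ s))) := by
      intro s
      rw [expectation_const_mul, expectation_const_mul, expectation_sub, expectation_const]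
      rfl
    refine Eq.trans ?_ (e.trans ((M.expectation_sum pol _ _ T _).trans
      (Finset.sum_congr rfl fun s _ => e1 s)))
    congr 1
    funext z
    simp_rw [value_eq _ hU, ← Finset.sum_sub_distrib, ← mul_sub, ← Finset.sum_sub_distrib,
      ← sub_mul]
    refine Finset.sum_congr rfl fun s _ => ?_
    congr 1
    refine Finset.sum_congr rfl fun a _ => ?_
    congr 1
    simp only [binaryLoss]
    split_ifs <;> simp
  simp_rw [key]
  rw [Finset.sum_comm, Finset.mul_sum]
  refine le_of_eq (Finset.sum_congr rfl fun s _ => ?_)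
  simp_rw [Finset.mul_sum]
  exact Finset.sum_congr rfl fun t _ => by ring

theorem sum_actionProb (m : 𝒮 → 𝒜 → ℝ) {T : ℕ} (t : Fin T) (s : 𝒮) :
    ∑ a, actionProb pol M m t s a = 1 := by
  unfold actionProb
  rw [← expectation_sum]
  simp_rw [stdSimplex.sum_eq_one]
  exact M.expectation_const pol m T 1

/-- Under the reference law the probabilities sum to one, and Cauchy–Schwarz over the actions bounds
the sum of the deviations, since all actions at `s` share the same `T` episodes. -/
theorem sum_actionProb_update_le (hU : M.HasUniformTransitions) {ε : ℝ} (hε : 0 ≤ ε)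
    (hε' : ε < 1 / 2) (π₀ : 𝒮 → 𝒜) {T : ℕ} (t : Fin T) (s : 𝒮) :
    ∑ a, actionProb pol M (hiddenPolicyMean ε (Function.update π₀ s a)) t s a ≤
      1 + √(Fintype.card 𝒜 * (-Real.log (1 - 4 * ε ^ 2) / 2 * (M.occupancy s * T))) := by
  set K := -Real.log (1 - 4 * ε ^ 2) / 2 with hK
  have hK0 : 0 ≤ K := by
    have := Real.log_nonpos (x := 1 - 4 * ε ^ 2) (by nlinarith) (by nlinarith)
    linarith
  -- The reference environment hides nothing at `s` and agrees with `π₀` elsewhere, so it does not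
  -- depend on `a`.
  set m : 𝒮 → 𝒜 → ℝ := fun s' a => if s' = s then 1 / 2 else hiddenPolicyMean ε π₀ s' a with hm
  have h0 : ∀ s a, 0 ≤ m s a := fun s' a => by
    simp only [hm]
    split_ifs
    · norm_num
    · exact hiddenPolicyMean_nonneg hε'.le π₀ s' a
  have h1 : ∀ s a, m s a ≤ 1 := fun s' a => by
    simp only [hm]
    split_ifs
    · norm_num
    · exact hiddenPolicyMean_le_one hε π₀ s' a
  have hle : ∀ a, actionProb pol M (hiddenPolicyMean ε (Function.update π₀ s a)) t s a ≤
      actionProb pol M m t s a +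
        √(K * (M.occupancy s * ∑ t : Fin T, actionProb pol M m t s a)) := by
    intro a
    refine sub_le_iff_le_add'.mp (M.expectation_seen_sub_le pol hU hε hε' h0 h1 (s := s) (a := a)
      (by simp [hm]) (by simp [hiddenPolicyMean]) ?_
      (fun o => (pol t (fun i => o (Fin.castLE t.isLt.le i)) s : 𝒜 → ℝ) a)
      (fun o => (pol t _ s).2.1 a) fun o => (mem_Icc_of_mem_stdSimplex (pol t _ s).2 a).2)
    intro s' a' hne
    by_cases hs : s' = s
    · subst hs
      have : a' ≠ a := fun e => hne (by rw [e])
      simp [hm, hiddenPolicyMean, this]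
    · simp [hm, hiddenPolicyMean, hs]
  refine (Finset.sum_le_sum fun a _ => hle a).trans ?_
  rw [Finset.sum_add_distrib, sum_actionProb]
  refine add_le_add_right (Real.le_sqrt_of_sq_le ?_) 1
  refine sq_sum_le_card_mul_sum_sq.trans ?_
  rw [Finset.card_univ]
  refine mul_le_mul_of_nonneg_left (le_of_eq ?_) (Nat.cast_nonneg _)
  have hp : ∀ a, 0 ≤ ∑ t : Fin T, actionProb pol M m t s a := fun a =>
    Finset.sum_nonneg fun t _ => (M.expectation_const pol m T 0).symm.le.trans
      (expectation_mono h0 h1 fun z => (policyAt pol t _ s).2.1 a)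
  simp_rw [fun a => Real.sq_sqrt (mul_nonneg hK0 (mul_nonneg (occupancy_nonneg (M := M) s) (hp a)))]
  rw [← Finset.mul_sum, ← Finset.mul_sum, Finset.sum_comm]
  simp_rw [sum_actionProb]
  simp

/-- Averaged over the hidden policies, the regret is large. -/
theorem le_sum_bernoulliRegret (hU : M.HasUniformTransitions) {ε : ℝ} (hε : 0 ≤ ε)
    (hε' : ε < 1 / 2) (T : ℕ) (I : Finset 𝒮) {δ : ℝ}
    (hδ : ∀ s ∈ I, 1 + √(Fintype.card 𝒜 * (-Real.log (1 - 4 * ε ^ 2) / 2 *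
      (M.occupancy s * T))) ≤ (1 - δ) * Fintype.card 𝒜) :
    Fintype.card (𝒮 → 𝒜) * (ε * ∑ s ∈ I, M.occupancy s * (T * δ)) ≤
      ∑ π₀ : 𝒮 → 𝒜, M.bernoulliRegret pol (hiddenPolicyMean ε π₀) T := by
  refine le_trans ?_ (Finset.sum_le_sum fun π₀ _ => le_bernoulliRegret pol hU hε hε'.le π₀ T)
  rw [← Finset.mul_sum, mul_left_comm]
  refine mul_le_mul_of_nonneg_left ?_ hε
  rw [Finset.sum_comm, Finset.mul_sum]
  have hcomm : ∀ s, ∑ π₀ : 𝒮 → 𝒜, M.occupancy s *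
      ∑ t : Fin T, (1 - actionProb pol M (hiddenPolicyMean ε π₀) t s (π₀ s)) =
      M.occupancy s * ∑ t : Fin T, ∑ π₀ : 𝒮 → 𝒜,
        (1 - actionProb pol M (hiddenPolicyMean ε π₀) t s (π₀ s)) := fun s => by
    rw [← Finset.mul_sum, Finset.sum_comm]
  have hprob : ∀ (π₀ : 𝒮 → 𝒜) (t : Fin T) s a,
      actionProb pol M (hiddenPolicyMean ε π₀) t s a ≤ 1 := fun π₀ t s a =>
    (expectation_mono (hiddenPolicyMean_nonneg hε'.le π₀) (hiddenPolicyMean_le_one hε π₀)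
      fun z => (mem_Icc_of_mem_stdSimplex (policyAt pol t _ s).2 a).2).trans
      (M.expectation_const pol _ T 1).le
  simp_rw [hcomm]
  refine le_trans (Finset.sum_le_sum fun s hs => ?_)
    (Finset.sum_le_sum_of_subset_of_nonneg (Finset.subset_univ I) fun s _ _ =>
      mul_nonneg (occupancy_nonneg s) (Finset.sum_nonneg fun t _ => Finset.sum_nonneg fun π₀ _ =>
        sub_nonneg.mpr (hprob π₀ t s _)))
  rw [mul_left_comm]
  refine mul_le_mul_of_nonneg_left ?_ (occupancy_nonneg s)
  have hstep : ∀ t : Fin T, Fintype.card (𝒮 → 𝒜) * δ ≤ ∑ π₀ : 𝒮 → 𝒜,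
      (1 - actionProb pol M (hiddenPolicyMean ε π₀) t s (π₀ s)) := by
    intro t
    rcases isEmpty_or_nonempty 𝒜 with h𝒜 | h𝒜
    · have : IsEmpty (𝒮 → 𝒜) := ⟨fun f => h𝒜.elim (f s)⟩
      simp
    have hA : (0 : ℝ) < Fintype.card 𝒜 := by exact_mod_cast Fintype.card_pos
    -- Drawing `π₀` and then resampling its action at `s` is the same as drawing `π₀`; this reduces
    -- the average to the bound for a single state.
    have e := sum_sum_update (κ := 𝒜) s fun π₀ : 𝒮 → 𝒜 =>
      actionProb pol M (hiddenPolicyMean ε π₀) t s (π₀ s)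
    simp only [Function.update_self] at e
    have hle := Finset.sum_le_sum fun (π₀ : 𝒮 → 𝒜) (_ : π₀ ∈ Finset.univ) =>
      (sum_actionProb_update_le pol hU hε hε' π₀ t s).trans (hδ s hs)
    rw [e, Finset.sum_const, nsmul_eq_mul, Finset.card_univ] at hle
    rw [Finset.sum_sub_distrib, Finset.sum_const, nsmul_eq_mul, Finset.card_univ]
    have : ∑ π₀ : 𝒮 → 𝒜, actionProb pol M (hiddenPolicyMean ε π₀) t s (π₀ s) ≤
        Fintype.card (𝒮 → 𝒜) * (1 - δ) := by
      refine le_of_mul_le_mul_left ?_ hA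
      linarith
    linarith
  refine le_trans (le_of_eq ?_) (Finset.sum_le_sum fun t _ => hstep t)
  simp only [Finset.sum_const, Finset.card_univ, Fintype.card_fin, nsmul_eq_mul]
  ring

end Regret

end LayeredMDP

/-! ### Randomized learners, and passage to deterministic losses -/

namespace LayeredMDP

section Randomized

open MeasureTheory

variable {H : ℕ} {𝒮 𝒜 Ω : Type*} [Fintype 𝒮] [DecidableEq 𝒮] [Fintype 𝒜] [MeasurableSpace Ω]
  (M : LayeredMDP H 𝒮 𝒜)

theorem pathProb_le_one (π : Policy 𝒮 𝒜) {n : ℕ} (x : Fin n → 𝒮 × 𝒜) : M.pathProb π x ≤ 1 := by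
  classical
  rw [← M.sum_pathProb π n]
  exact Finset.single_le_sum (fun x _ => M.pathProb_nonneg π x) (Finset.mem_univ x)

theorem value_le (π : Policy 𝒮 𝒜) (ℓ : Loss 𝒮 𝒜) : M.value π ℓ ≤ H := by
  unfold value
  calc _ ≤ ∑ x : Fin H → 𝒮 × 𝒜, M.pathProb π x * H := by
        refine Finset.sum_le_sum fun x _ => mul_le_mul_of_nonneg_left ?_ (M.pathProb_nonneg π x)
        calc _ ≤ ∑ _h : Fin H, (1 : ℝ) := Finset.sum_le_sum fun h _ => (ℓ (x h).1 (x h).2).2.2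
          _ = H := by simp
    _ = H := by rw [← Finset.sum_mul, sum_pathProb, one_mul]

/-- The infimum does not depend on the played policies, hence is constant in the internal randomness
and can stay unestimated for integrability. -/
theorem abs_regret_le {T : ℕ} (ℓ : Fin T → Loss 𝒮 𝒜) (π : Fin T → Policy 𝒮 𝒜) :
    |M.regret ℓ π| ≤ T * H + |⨅ ρ : Policy 𝒮 𝒜, ∑ t, M.value ρ (ℓ t)| := by
  unfold regret
  refine (abs_sub _ _).trans (add_le_add_left ?_ _)
  rw [abs_of_nonneg (Finset.sum_nonneg fun t _ => value_nonneg _ _)]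
  calc _ ≤ ∑ _t : Fin T, (H : ℝ) := Finset.sum_le_sum fun t _ => M.value_le _ _
    _ = T * H := by simp

theorem measurable_pathProb {π : Ω → Policy 𝒮 𝒜}
    (hπ : ∀ s a, Measurable fun ω => (π ω s : 𝒜 → ℝ) a) {n : ℕ} (x : Fin n → 𝒮 × 𝒜) :
    Measurable fun ω => M.pathProb (π ω) x :=
  Finset.measurable_prod _ fun h _ => (hπ (x h).1 (x h).2).const_mul _

theorem measurable_regret {T : ℕ} (ℓ : Fin T → Loss 𝒮 𝒜) {π : Ω → Fin T → Policy 𝒮 𝒜}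
    (hπ : ∀ t s a, Measurable fun ω => (π ω t s : 𝒜 → ℝ) a) :
    Measurable fun ω => M.regret ℓ (π ω) :=
  (Finset.measurable_sum _ fun t _ => Finset.measurable_sum _ fun x _ =>
    (M.measurable_pathProb (hπ t) x).mul_const _).sub_const _

theorem integrable_regret (μ : Measure Ω) [IsFiniteMeasure μ] (L : Learner H 𝒮 𝒜 Ω) {T : ℕ}
    (ℓ : Fin T → Loss 𝒮 𝒜) :
    Integrable (fun ω => ∑ x : Fin T → Fin H → 𝒮 × 𝒜,
      (∏ t, M.pathProb (played L ℓ ω x t) (x t)) * M.regret ℓ (played L ℓ ω x)) μ := by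
  refine integrable_finsetSum _ fun x _ => ?_
  have hm : ∀ t s a, Measurable fun ω => (played L ℓ ω x t s : 𝒜 → ℝ) a := fun t s a =>
    L.measurable_policy _ _ s a
  refine Integrable.of_bound (((Finset.measurable_prod _ fun t _ =>
    M.measurable_pathProb (hm t) (x t)).mul (M.measurable_regret ℓ hm)).aestronglyMeasurable)
    (1 * (T * H + |⨅ ρ : Policy 𝒮 𝒜, ∑ t, M.value ρ (ℓ t)|))
    (Filter.Eventually.of_forall fun ω => ?_)
  rw [Real.norm_eq_abs, abs_mul]
  refine mul_le_mul ?_ (M.abs_regret_le _ _) (abs_nonneg _) zero_le_one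
  rw [abs_of_nonneg (Finset.prod_nonneg fun t _ => M.pathProb_nonneg _ _)]
  exact Finset.prod_le_one (fun t _ => M.pathProb_nonneg _ _) fun t _ => M.pathProb_le_one _ _

variable [DecidableEq 𝒜]

/-- Drawing all tables in advance or one per episode gives the same joint weight after regrouping by
episode. With `ω` fixed, the learner has no internal randomness. -/
theorem sum_tables_eq_bernoulliRegret (L : Learner H 𝒮 𝒜 Ω) (ω : Ω) (T : ℕ) (m : 𝒮 → 𝒜 → ℝ) :
    ∑ b : Fin T → 𝒮 → 𝒜 → Bool, (∏ t, ∏ s, ∏ a, if b t s a then m s a else 1 - m s a) *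
      ∑ x : Fin T → Fin H → 𝒮 × 𝒜, (∏ t, M.pathProb (played L (binaryLoss b) ω x t) (x t)) *
        M.regret (binaryLoss b) (played L (binaryLoss b) ω x) =
    M.bernoulliRegret (L.policy ω) m T := by
  unfold bernoulliRegret expectation
  rw [← Equiv.sum_comp (Equiv.arrowProdEquivProdArrow (Fin T) (fun _ => 𝒮 → 𝒜 → Bool)
    fun _ => Fin H → 𝒮 × 𝒜).symm, Fintype.sum_prod_type]
  refine Finset.sum_congr rfl fun b _ => ?_
  rw [Finset.mul_sum]
  refine Finset.sum_congr rfl fun x _ => ?_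
  rw [← mul_assoc, ← Finset.prod_mul_distrib]
  rfl

theorem expectedRegretBernoulli_eq (μ : Measure Ω) [IsFiniteMeasure μ] (L : Learner H 𝒮 𝒜 Ω)
    (T : ℕ) (m : 𝒮 → 𝒜 → ℝ) :
    M.expectedRegretBernoulli μ L T m = ∫ ω, M.bernoulliRegret (L.policy ω) m T ∂μ := by
  simp_rw [← sum_tables_eq_bernoulliRegret]
  rw [integral_finsetSum _ fun b _ => (M.integrable_regret μ L (binaryLoss b)).const_mul _]
  simp_rw [integral_const_mul]
  rfl

theorem integrable_bernoulliRegret (μ : Measure Ω) [IsFiniteMeasure μ] (L : Learner H 𝒮 𝒜 Ω)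
    (T : ℕ) (m : 𝒮 → 𝒜 → ℝ) :
    Integrable (fun ω => M.bernoulliRegret (L.policy ω) m T) μ := by
  simp_rw [← sum_tables_eq_bernoulliRegret]
  exact integrable_finsetSum _ fun b _ => (M.integrable_regret μ L (binaryLoss b)).const_mul _

/-- The averaged bound holds for every `ω`; integrating before choosing makes the hidden policy
independent of `ω`. -/
theorem exists_le_expectedRegretBernoulli [Nonempty 𝒜] (μ : Measure Ω) [IsProbabilityMeasure μ]
    (L : Learner H 𝒮 𝒜 Ω) (T : ℕ) (ε B : ℝ)
    (hB : ∀ pol : (t : ℕ) → History H 𝒮 𝒜 t → Policy 𝒮 𝒜, Fintype.card (𝒮 → 𝒜) * B ≤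
      ∑ π₀ : 𝒮 → 𝒜, M.bernoulliRegret pol (hiddenPolicyMean ε π₀) T) :
    ∃ π₀ : 𝒮 → 𝒜, B ≤ M.expectedRegretBernoulli μ L T (hiddenPolicyMean ε π₀) := by
  have h := integral_mono (μ := μ) (integrable_const _)
    (integrable_finsetSum Finset.univ fun π₀ _ =>
      M.integrable_bernoulliRegret μ L T (hiddenPolicyMean ε π₀)) fun ω => hB (L.policy ω)
  rw [integral_finsetSum _ fun π₀ _ =>
    M.integrable_bernoulliRegret μ L T (hiddenPolicyMean ε π₀)] at h
  simp_rw [← expectedRegretBernoulli_eq] at h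
  obtain ⟨π₀, -, hπ₀⟩ := Finset.exists_le_of_sum_le (s := (Finset.univ : Finset (𝒮 → 𝒜)))
    (f := fun _ => B) Finset.univ_nonempty (by simpa using h)
  exact ⟨π₀, hπ₀⟩

/-- If the expected regret is large for random losses, then it is for some deterministic losses. -/
theorem exists_le_expectedRegret (μ : Measure Ω) (L : Learner H 𝒮 𝒜 Ω) (T : ℕ) {B : ℝ}
    {m : 𝒮 → 𝒜 → ℝ} (h0 : ∀ s a, 0 ≤ m s a) (h1 : ∀ s a, m s a ≤ 1)
    (hB : B ≤ M.expectedRegretBernoulli μ L T m) :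
    ∃ ℓ : Fin T → Loss 𝒮 𝒜, B ≤ M.expectedRegret μ L ℓ := by
  by_contra! hlt
  have hsum : ∑ b : Fin T → 𝒮 → 𝒜 → Bool, ∏ t, tableWeight m (b t) = 1 := by
    have h := Finset.prod_univ_sum (fun _ : Fin T => (Finset.univ : Finset (𝒮 → 𝒜 → Bool)))
      fun _ b => tableWeight m b
    rw [Fintype.piFinset_univ] at h
    rw [← h]
    exact Finset.prod_eq_one fun t _ => sum_tableWeight m
  have hnn : ∀ b : Fin T → 𝒮 → 𝒜 → Bool, 0 ≤ ∏ t, tableWeight m (b t) := fun b =>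
    Finset.prod_nonneg fun t _ => tableWeight_nonneg h0 h1 (b t)
  -- The contradiction needs one table of positive weight, so that the weighted average is strictly
  -- below `B`.
  obtain ⟨b, -, hb⟩ : ∃ b ∈ (Finset.univ : Finset (Fin T → 𝒮 → 𝒜 → Bool)),
      0 < ∏ t, tableWeight m (b t) := by
    by_contra! hle
    have := Finset.sum_nonpos hle
    linarith
  have : M.expectedRegretBernoulli μ L T m <
      ∑ b : Fin T → 𝒮 → 𝒜 → Bool, (∏ t, tableWeight m (b t)) * B :=
    Finset.sum_lt_sum (fun b _ => mul_le_mul_of_nonneg_left (hlt _).le (hnn b))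
      ⟨b, Finset.mem_univ b, mul_lt_mul_of_pos_left (hlt _) hb⟩
  rw [← Finset.sum_mul, hsum, one_mul] at this
  linarith

end Randomized

/-! ### Construction of the MDP -/

section Construction

variable {H : ℕ} {𝒮 : Type*} (𝒜 : Type*) [Fintype 𝒮] [DecidableEq 𝒮]

/-- The layered MDP with the given layers and uniform transitions. -/
noncomputable def uniform (layer : 𝒮 → Fin (H + 1)) (s₀ sH : 𝒮) (h0 : ∀ s, layer s = 0 ↔ s = s₀)
    (hlast : ∀ s, layer s = Fin.last H ↔ s = sH) (hne : ∀ h, ∃ s, layer s = h) :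
    LayeredMDP H 𝒮 𝒜 where
  s₀ := s₀
  sH := sH
  layer := layer
  P s _ :=
    -- The terminal state loops. This is an arbitrary choice: both `forward` and uniformity say
    -- nothing there.
    if hs : layer s = Fin.last H then ⟨Pi.single sH 1, single_mem_stdSimplex ℝ _⟩
    else ⟨fun s' => if (layer s' : ℕ) = layer s + 1 then
        1 / ((Finset.univ.filter fun s'' => (layer s'' : ℕ) = layer s + 1).card : ℝ) else 0, by
      have hlt : (layer s : ℕ) + 1 < H + 1 := by
        have h1 := (layer s).isLt
        have h2 : (layer s : ℕ) ≠ H := fun e => hs (Fin.ext e)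
        omega
      obtain ⟨s', hs'⟩ := hne ⟨layer s + 1, hlt⟩
      have hpos : 0 < (Finset.univ.filter fun s'' => (layer s'' : ℕ) = layer s + 1).card :=
        Finset.card_pos.mpr ⟨s', by simp [hs']⟩
      refine ⟨fun s' => by positivity, ?_⟩
      rw [← Finset.sum_filter, Finset.sum_const, nsmul_eq_mul]
      field_simp⟩
  layer_zero := h0
  layer_last := hlast
  layer_nonempty := hne
  forward s a s' hs hP := by
    by_contra hne
    rw [dif_neg hs] at hP
    exact hP (if_neg hne)

theorem uniform_hasUniformTransitions (layer : 𝒮 → Fin (H + 1)) (s₀ sH : 𝒮)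
    (h0 : ∀ s, layer s = 0 ↔ s = s₀) (hlast : ∀ s, layer s = Fin.last H ↔ s = sH)
    (hne : ∀ h, ∃ s, layer s = h) :
    (uniform 𝒜 layer s₀ sH h0 hlast hne).HasUniformTransitions := by
  intro s a s' hs'
  change (layer s' : ℕ) = layer s + 1 at hs'
  have hs : layer s ≠ Fin.last H := fun e => by
    have := (layer s').isLt
    rw [e, Fin.val_last] at hs'
    omega
  have hc : (uniform 𝒜 layer s₀ sH h0 hlast hne).layerCard (layer s') =
      (Finset.univ.filter fun s'' => (layer s'' : ℕ) = layer s + 1).card := by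
    unfold layerCard
    congr 1
    refine Finset.filter_congr fun s'' _ => ?_
    rw [← hs']
    exact Fin.ext_iff
  change _ = 1 / ((uniform 𝒜 layer s₀ sH h0 hlast hne).layerCard (layer s') : ℝ)
  rw [hc]
  simp only [uniform, dif_neg hs]
  exact if_pos hs'

end Construction

theorem exists_uniform (𝒜 : Type*) {H S S' : ℕ} (hH : 2 ≤ H) (hS' : 1 ≤ S')
    (hS : S = (H - 1) * S' + 2) : ∃ M : LayeredMDP H (Fin S) 𝒜,
      (∀ h : Fin (H + 1), h ≠ 0 → h ≠ Fin.last H → M.layerCard h = S') ∧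
        M.HasUniformTransitions := by
  -- The outer `none` is the initial state, the inner one the terminal state, and the pairs form the
  -- inner layers, shifted by one.
  let lay : Option (Option (Fin (H - 1) × Fin S')) → Fin (H + 1)
    | none => 0
    | some none => Fin.last H
    | some (some q) => ⟨q.1 + 1, by omega⟩
  let e : Fin S ≃ Option (Option (Fin (H - 1) × Fin S')) :=
    Fintype.equivOfCardEq (by simp [hS])
  have hmid : ∀ (h : Fin (H + 1)) (h0 : h ≠ 0) (hl : h ≠ Fin.last H) (j : Fin S'),
      ∃ i : Fin (H - 1), lay (some (some (i, j))) = h := by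
    intro h h0 hl j
    have h1 : (h : ℕ) ≠ 0 := fun e => h0 (Fin.ext e)
    have h2 : (h : ℕ) ≠ H := fun e => hl (Fin.ext e)
    have h3 := h.isLt
    exact ⟨⟨h - 1, by omega⟩, Fin.ext (by simp only [lay]; omega)⟩
  have l0 : ∀ y, lay y = 0 ↔ y = none := by
    rintro (_ | _ | q)
    · simp [lay]
    · simp [lay, Fin.ext_iff]; omega
    · simp [lay, Fin.ext_iff]
  have ll : ∀ y, lay y = Fin.last H ↔ y = some none := by
    rintro (_ | _ | q)
    · simp [lay, Fin.ext_iff]; omega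
    · simp [lay]
    · have := q.1.isLt
      simp [lay, Fin.ext_iff]; omega
  refine ⟨uniform 𝒜 (fun s => lay (e s)) (e.symm none) (e.symm (some none))
    (fun s => by rw [l0, Equiv.eq_symm_apply]) (fun s => by rw [ll, Equiv.eq_symm_apply])
    (fun h => ?_), fun h h0 hl => ?_, uniform_hasUniformTransitions 𝒜 _ _ _ _ _ _⟩
  · by_cases h0 : h = 0
    · exact ⟨e.symm none, by simp [h0, lay]⟩
    by_cases hl : h = Fin.last H
    · exact ⟨e.symm (some none), by simp [hl, lay]⟩
    obtain ⟨i, hi⟩ := hmid h h0 hl ⟨0, hS'⟩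
    exact ⟨e.symm (some (some (i, ⟨0, hS'⟩))), by simp [hi]⟩
  · obtain ⟨i, hi⟩ := hmid h h0 hl ⟨0, hS'⟩
    have : (Finset.univ.filter fun s => lay (e s) = h) =
        Finset.univ.image fun j : Fin S' => e.symm (some (some (i, j))) := by
      ext s
      simp only [Finset.mem_filter, Finset.mem_univ, true_and, Finset.mem_image]
      constructor
      · intro hs
        rcases hy : e s with _ | _ | ⟨i', j⟩
        · exact absurd (by rw [← hs, hy]) h0
        · exact absurd (by rw [← hs, hy]) hl
        · refine ⟨j, ?_⟩
          rw [Equiv.symm_apply_eq, hy]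
          rw [hy, ← hi] at hs
          have : i' = i := by
            simp only [lay, Fin.ext_iff] at hs
            exact Fin.ext (by omega)
          rw [this]
      · rintro ⟨j, rfl⟩
        rw [Equiv.apply_symm_apply, ← hi]
    change (Finset.univ.filter fun s => lay (e s) = h).card = S'
    rw [this, Finset.card_image_of_injective]
    · simp
    · intro j j' hj
      simpa using hj

/-- The number of states outside of the first and the last layer. -/
theorem card_inner {H : ℕ} {𝒮 𝒜 : Type*} [Fintype 𝒮] (M : LayeredMDP H 𝒮 𝒜) (hH : H ≠ 0) :
    (Finset.univ.filter fun s => M.layer s ≠ 0 ∧ M.layer s ≠ Fin.last H).card + 2 =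
      Fintype.card 𝒮 := by
  classical
  have hne : M.s₀ ≠ M.sH := fun e => by
    have h1 := (M.layer_zero M.s₀).mpr rfl
    have h2 := (M.layer_last M.s₀).mpr e
    rw [h1, Fin.ext_iff] at h2
    exact hH h2.symm
  have : (Finset.univ.filter fun s => M.layer s ≠ 0 ∧ M.layer s ≠ Fin.last H) =
      ({M.s₀, M.sH} : Finset 𝒮)ᶜ := by
    ext s
    simp only [Finset.mem_filter, Finset.mem_univ, true_and, Finset.mem_compl, Finset.mem_insert,
      Finset.mem_singleton, ne_eq, M.layer_zero, M.layer_last, not_or]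
  rw [this, ← Finset.card_pair hne, Finset.card_compl_add_card]

end LayeredMDP

/-! ### Choice of the gap and the constants -/

namespace LayeredMDP

/-- With `x = 4 * ε ^ 2 ≤ 1 / 4`, one has `-log (1 - x) ≤ 1 / (1 - x) - 1 ≤ 2 * x`. -/
theorem neg_log_one_sub_div_two_le {ε : ℝ} (hε : 0 ≤ ε) (hε' : ε ≤ 1 / 4) :
    -Real.log (1 - 4 * ε ^ 2) / 2 ≤ 4 * ε ^ 2 := by
  have hx : 4 * ε ^ 2 ≤ 1 / 4 := by nlinarith
  have hpos : 0 < 1 - 4 * ε ^ 2 := by linarith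
  have h := Real.one_sub_inv_le_log_of_pos hpos
  have : (1 - 4 * ε ^ 2)⁻¹ ≤ 1 + 2 * (4 * ε ^ 2) := by
    rw [inv_le_iff_one_le_mul₀ hpos]
    nlinarith [sq_nonneg ε]
  linarith

/-- The regret lower bound for uniform transitions between layers of equal size. -/
theorem le_sum_bernoulliRegret_of_layerCard {H S A T S' : ℕ} (hH : 3 ≤ H) (hA : 5 ≤ A)
    (hS' : 1 ≤ S') (hT : 0 < T) (hS : S = (H - 1) * S' + 2) {M : LayeredMDP H (Fin S) (Fin A)}
    (hM : ∀ h : Fin (H + 1), h ≠ 0 → h ≠ Fin.last H → M.layerCard h = S')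
    (hU : M.HasUniformTransitions) {ε : ℝ} (hε : 0 ≤ ε) (hε' : ε ≤ 1 / 4)
    (hεT : 64 * ε ^ 2 * T ≤ S' * A) (pol : (t : ℕ) → History H (Fin S) (Fin A) t →
      Policy (Fin S) (Fin A)) :
    Fintype.card (Fin S → Fin A) * (ε * ((H - 1) * (T * (1 / 2)))) ≤
      ∑ π₀ : Fin S → Fin A, M.bernoulliRegret pol (hiddenPolicyMean ε π₀) T := by
  have hS'0 : (0 : ℝ) < S' := by exact_mod_cast hS'
  have hA5 : (5 : ℝ) ≤ A := by exact_mod_cast hA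
  have hocc : ∀ s ∈ Finset.univ.filter fun s => M.layer s ≠ 0 ∧ M.layer s ≠ Fin.last H,
      M.occupancy s = 1 / S' := by
    intro s hs
    simp only [Finset.mem_filter, Finset.mem_univ, true_and] at hs
    rw [occupancy_eq hs.2, hM _ hs.1 hs.2]
  have h := le_sum_bernoulliRegret pol hU hε (by linarith) T
    (Finset.univ.filter fun s => M.layer s ≠ 0 ∧ M.layer s ≠ Fin.last H) (δ := 1 / 2) ?_
  · refine le_trans (le_of_eq ?_) h
    congr 2
    rw [Finset.sum_congr rfl fun s hs => by rw [hocc s hs], Finset.sum_const, nsmul_eq_mul]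
    have hc := M.card_inner (by omega)
    rw [Fintype.card_fin] at hc
    have hc' : (Finset.univ.filter fun s => M.layer s ≠ 0 ∧ M.layer s ≠ Fin.last H).card =
        (H - 1) * S' := by omega
    rw [hc', Nat.cast_mul, Nat.cast_sub (by omega)]
    field_simp
    simp
  · intro s hs
    rw [hocc s hs, Fintype.card_fin]
    have hK := neg_log_one_sub_div_two_le hε hε'
    -- The target is `1 + A / 4 ≤ A / 2`, which holds as `A ≥ 4`.
    have hsq : √(A * (-Real.log (1 - 4 * ε ^ 2) / 2 * (1 / S' * T))) ≤ A / 4 := by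
      refine Real.sqrt_le_iff.mpr ⟨by positivity, ?_⟩
      calc (A : ℝ) * (-Real.log (1 - 4 * ε ^ 2) / 2 * (1 / S' * T))
          ≤ A * (4 * ε ^ 2 * (1 / S' * T)) := by gcongr
        _ = A * (64 * ε ^ 2 * T) / (16 * S') := by field_simp; ring
        _ ≤ A * (S' * A) / (16 * S') := by gcongr
        _ = (A / 4) ^ 2 := by field_simp; ring
    linarith

end LayeredMDP

theorem theorem1 :
    ∃ c : ℝ, 0 < c ∧
      ∀ H S A T S' : ℕ, 3 ≤ H → 5 ≤ A → 1 ≤ S' → S = (H - 1) * S' + 2 → S * A ≤ H * T →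
        ∃ M : LayeredMDP H (Fin S) (Fin A),
          (∀ h : Fin (H + 1), h ≠ 0 → h ≠ Fin.last H → M.layerCard h = S') ∧
          M.HasUniformTransitions ∧
          ∃ ε : ℝ, 0 < ε ∧ ε ≤ 1 / 4 ∧
            ∀ (Ω : Type*) [MeasurableSpace Ω] (μ : MeasureTheory.Measure Ω)
              [MeasureTheory.IsProbabilityMeasure μ] (L : Learner H (Fin S) (Fin A) Ω),
              (∃ π₀ : Fin S → Fin A,
                c * Real.sqrt ((H : ℝ) * S * A * T) ≤
                  M.expectedRegretBernoulli μ L T (hiddenPolicyMean ε π₀)) ∧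
              (∃ ℓ : Fin T → Loss (Fin S) (Fin A),
                c * Real.sqrt ((H : ℝ) * S * A * T) ≤ M.expectedRegret μ L ℓ) := by
  refine ⟨1 / 32, by norm_num, fun H S A T S' hH hA hS' hS hT => ?_⟩
  obtain ⟨M, hM, hU⟩ := LayeredMDP.exists_uniform (Fin A) (H := H) (by omega) hS' hS
  have hT0 : 0 < T := by
    rcases Nat.eq_zero_or_pos T with h | h
    · subst h
      have : 0 < S * A := Nat.mul_pos (by omega) (by omega)
      omega
    · exact h
  have hTr : (0 : ℝ) < T := by exact_mod_cast hT0
  have hS'r : (1 : ℝ) ≤ S' := by exact_mod_cast hS'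
  have hAr : (5 : ℝ) ≤ A := by exact_mod_cast hA
  have hHr : (3 : ℝ) ≤ H := by exact_mod_cast hH
  have hSr : (S : ℝ) = (H - 1) * S' + 2 := by
    rw [hS, Nat.cast_add, Nat.cast_mul, Nat.cast_sub (by omega)]
    simp
  have hSAT : (S : ℝ) * A ≤ H * T := by exact_mod_cast hT
  -- From `(H - 1) * S' ≤ S` and `H ≤ 2 * (H - 1)`; this is what makes `ε ≤ 1 / 4` below.
  have hT2 : (S' : ℝ) * A ≤ 2 * T := by
    have h1 : ((H : ℝ) - 1) * (S' * A) ≤ (H - 1) * (2 * T) := by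
      have h2 : ((H : ℝ) - 1) * S' * A ≤ S * A :=
        mul_le_mul_of_nonneg_right (by linarith) (by linarith)
      nlinarith
    exact le_of_mul_le_mul_left h1 (by linarith)
  have hsq : √((S' : ℝ) * A / T) ^ 2 = S' * A / T := Real.sq_sqrt (by positivity)
  have hpos : 0 < √((S' : ℝ) * A / T) := Real.sqrt_pos.mpr (by positivity)
  -- The largest gap allowed by `64 * ε ^ 2 * T ≤ S' * A`.
  set ε : ℝ := √((S' : ℝ) * A / T) / 8 with hε
  have hε0 : 0 < ε := by positivity
  have hε4 : ε ≤ 1 / 4 := by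
    have : √((S' : ℝ) * A / T) ≤ 2 := by
      refine Real.sqrt_le_iff.mpr ⟨by norm_num, ?_⟩
      rw [div_le_iff₀ hTr]
      linarith
    linarith
  have hεT : 64 * ε ^ 2 * T = S' * A := by
    rw [hε, div_pow, hsq]
    field_simp
    norm_num
  have hbound : 1 / 32 * √((H : ℝ) * S * A * T) ≤ ε * ((H - 1) * (T * (1 / 2))) := by
    have h1 : √((H : ℝ) * S * A * T) ≤ 16 * (ε * ((H - 1) * T)) := by
      refine Real.sqrt_le_iff.mpr
        ⟨mul_nonneg (by norm_num) (mul_nonneg hε0.le (mul_nonneg (by linarith) hTr.le)), ?_⟩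
      have h2 : (16 * (ε * (((H : ℝ) - 1) * T))) ^ 2 = 4 * (H - 1) ^ 2 * (S' * A) * T := by
        rw [← hεT]
        ring
      -- As `H ≥ 3`, the two extreme states satisfy `2 ≤ (H - 1) * S'`, so `S` is at most twice the
      -- number of inner states.
      have h3 : (H : ℝ) * S ≤ 2 * (H - 1) * (2 * ((H - 1) * S')) :=
        mul_le_mul (by linarith) (by nlinarith) (Nat.cast_nonneg _) (by linarith)
      rw [h2]
      calc (H : ℝ) * S * A * T ≤ 2 * (H - 1) * (2 * ((H - 1) * S')) * A * T := by gcongr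
        _ = _ := by ring
    linarith
  have : Nonempty (Fin A) := ⟨⟨0, by omega⟩⟩
  refine ⟨M, hM, hU, ε, hε0, hε4, fun Ω _ μ _ L => ?_⟩
  obtain ⟨π₀, hπ₀⟩ := M.exists_le_expectedRegretBernoulli μ L T ε _
    (LayeredMDP.le_sum_bernoulliRegret_of_layerCard hH hA hS' hT0 hS hM hU hε0.le hε4 hεT.le)
  exact ⟨⟨π₀, hbound.trans hπ₀⟩, M.exists_le_expectedRegret μ L T
    (LayeredMDP.hiddenPolicyMean_nonneg (by linarith) π₀)
    (LayeredMDP.hiddenPolicyMean_le_one hε0.le π₀) (hbound.trans hπ₀)⟩
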